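/- **Setting.** Let $Var$ be a countably infinite set of quantum variables, each of type $\mathbf{Boolean}$ (state space $\mathcal H_2$ with computational basis $|0\rangle,|1\rangle$) or $\mathbf{integer}$ (state space $\mathcal H_\infty$ with computational basis $|n\rangle$, $n\in\mathbb Z$). The space $\mathcal H_{\bar q}$ of a finite register $\bar q$ is the tensor product of the spaces of its variables, and $\mathcal H_{\rm all}$ is the (separable) tensor product of the spaces of all variables, with orthonormal basis the product vectors $\bigotimes_q|c_q\rangle_q$ of computational basis vectors in which $c_q=0$ for all but finitely many $q$. An operator on $\mathcal H_{\bar q}$ is identified with its cylinder extension $A\otimes I$ to $\mathcal H_{\rm all}$. All operators are bounded; infinite sums of operators converge pointwise on vectors; $\sqsubseteq$ is the Löwner order. A partial density operator is a positive trace-class $\rho$ with $\mathrm{tr}(\rho)\le 1$; a quantum predicate is an operator $P$ on $\mathcal H_{\rm all}$ with $0\sqsubseteq P\sqsubseteq I$. **Programs.** $S::=\mathbf{skip}\mid q:=0\mid \bar q:=U\bar q\mid S_1;S_2\mid \mathbf{measure}\ M[\bar q]:\bar S\mid \mathbf{while}\ M[\bar q]=1\ \mathbf{do}\ S$, where $U^\dagger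 U=I$ on $\mathcal H_{\bar q}$; $M=\{M_m\}$ is a measurement on $\mathcal H_{\bar q}$, i.e. $\sum_m M_m^\dagger M_m=I$, with an arbitrary, possibly infinite, outcome set, and $\bar S=\{S_m\}$ is a family of programs, one for each outcome; in $\mathbf{while}$, $M=\{M_0,M_1\}$. **Semantics.** With $E$ the empty program and $E;S_2=S_2$, the transitions are: $\langle\mathbf{skip},\rho\rangle\to\langle E,\rho\rangle$; $\langle q:=0,\rho\rangle\to\langle E,\sum_n|0\rangle_q\langle n|\rho|n\rangle_q\langle 0|\rangle$ ($n$ running through the computational basis of $q$); $\langle\bar q:=U\bar q,\rho\rangle\to\langle E,U\rho U^\dagger\rangle$; $\langle S_1;S_2,\rho\rangle\to\langle S_1';S_2,\rho'\rangle$ whenever $\langle S_1,\rho\rangle\to\langle S_1',\rho'\rangle$; $\langle\mathbf{measure}\ M[\bar q]:\bar S,\rho\rangle\to\langle S_m,M_m\rho M_m^\dagger\rangle$ for each outcome $m$; and, writing $\mathbf{while}$ for $\mathbf{while}\ M[\bar q]=1\ \mathbf{do}\ S$, $\langle\mathbf{while},\rho\rangle\to\langle E,M_0\rho M_0^\dagger\rangle$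 and $\langle\mathbf{while},\rho\rangle\to\langle S;\mathbf{while},M_1\rho M_1^\dagger\rangle$. The semantic function is $[\![S]\!](\rho)=\sum\rho'$, the sum over all finite computations from $\langle S,\rho\rangle$ to some $\langle E,\rho'\rangle$, counted with multiplicity (different outcomes give different computations). The formula $\{P\}S\{Q\}$, with $P,Q$ quantum predicates, is true for partial correctness, $\models_{\rm par}\{P\}S\{Q\}$, if $$\mathrm{tr}(P\rho)\le \mathrm{tr}(Q[\![S]\!](\rho))+\big[\mathrm{tr}(\rho)-\mathrm{tr}([\![S]\!](\rho))\big]$$ for all partial density operators $\rho$ on $\mathcal H_{\rm all}$. **Proof system $qPD$.** All pre- and postconditions below are quantum predicates. Axioms: $\{P\}\mathbf{skip}\{P\}$; $\{\sum_n|n\rangle_q\langle 0|P|0\rangle_q\langle n|\}\,q:=0\,\{P\}$; $\{U^\dagger PU\}\,\bar q:=U\bar q\,\{P\}$. Rules: from $\{P\}S_1\{Q\}$ and $\{Q\}S_2\{R\}$ infer $\{P\}S_1;S_2\{R\}$; from $\{P_m\}S_m\{Q\}$ for all $m$ infer $\{\sum_mM_m^\dagger P_mM_m\}\,\mathbf{measure}\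 M[\bar q]:\bar S\,\{Q\}$; from $\{Q\}S\{R\}$ with $R=M_0^\dagger PM_0+M_1^\dagger QM_1$ infer $\{R\}\,\mathbf{while}\ M[\bar q]=1\ \mathbf{do}\ S\,\{P\}$; from $\{P'\}S\{Q'\}$ infer $\{P\}S\{Q\}$ whenever $P\sqsubseteq P'$ and $Q'\sqsubseteq Q$ are true (this is the sense in which completeness is relative). **Theorem (relative completeness of $qPD$).** For every quantum program $S$ and all quantum predicates $P,Q$ on $\mathcal H_{\rm all}$: if $\models_{\rm par}\{P\}S\{Q\}$, then $\{P\}S\{Q\}$ is derivable in $qPD$. -/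

import Mathlib

open scoped ENNReal

universe u

namespace QuantumWhile

/-! ### Hilbert spaces with a computational basis -/

/-- The Hilbert space of square-summable families of amplitudes over a set `C` of computational
basis labels. -/
abbrev L2 (C : Type*) : Type _ := lp (fun _ : C => ℂ) 2

/-- Bounded operators on the Hilbert space with computational basis `C`. -/
abbrev Op (C : Type*) : Type _ := L2 C →L[ℂ] L2 C

open Classical in
/-- The computational basis vector `|c⟩`. -/
noncomputable def ket {C : Type*} (c : C) : L2 C := lp.single 2 c (1 : ℂ)

/-- The operator `|c⟩⟨d|`. -/
noncomputable def ketBra {C : Type*} (c d : C) : Op C :=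
  (innerSL ℂ (ket d)).smulRight (ket c)

/-- The adjoint `A†`. -/
noncomputable abbrev adj {C : Type*} (A : Op C) : Op C := ContinuousLinearMap.adjoint A

/-- `HasOpSum f A`: the family `f` of operators is summable with sum `A`, i.e. for each vector `ψ`
the family of vectors `f i ψ` is (unconditionally) summable with sum `A ψ`. -/
def HasOpSum {ι C : Type*} (f : ι → Op C) (A : Op C) : Prop :=
  ∀ ψ : L2 C, HasSum (fun i => f i ψ) (A ψ)

open Classical in
/-- The sum of a summable family of operators (and `0` for a family that is not summable). -/
noncomputable def opSum {ι C : Type*} (f : ι → Op C) : Op C :=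
  if h : ∃ A, HasOpSum f A then h.choose else 0

/-- `A` is a trace operator: its diagonal is summable in every orthonormal basis. -/
def IsTraceOp {C : Type u} (A : Op C) : Prop :=
  ∀ (ι : Type u) (b : HilbertBasis ι ℂ (L2 C)), Summable fun i => inner ℂ (b i) (A (b i))

/-- The trace of an operator, computed in the computational basis. -/
noncomputable def trace {C : Type*} (A : Op C) : ℂ := ∑' c : C, inner ℂ (ket c) (A (ket c))

/-- Partial density operators: positive trace operators of trace at most `1`. -/
structure IsPartialDensity {C : Type u} (ρ : Op C) : Prop where
  positive : ρ.IsPositive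
  traceOp : IsTraceOp ρ
  trace_le : (trace ρ).re ≤ 1

/-! ### Cylinder extensions -/

section Cylinder

variable {C X Y : Type*} (e : C ≃ X × Y)

theorem hasSum_normSq {D : Type*} (ψ : L2 D) : HasSum (fun d => ‖ψ d‖ ^ 2) (‖ψ‖ ^ 2) := by
  have h := lp.hasSum_norm (p := 2) (by simp) ψ
  simpa using h

theorem mem_of_summable_normSq {D : Type*} {f : D → ℂ} (h : Summable fun d => ‖f d‖ ^ 2) :
    Memℓp f 2 := by
  apply memℓp_gen
  simpa using h

/-- Under an identification `C ≃ X × Y`, the part of the vector `ψ` of `L2 C` which has second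
label `y`, that is `(I ⊗ ⟨y|)ψ`. -/
noncomputable def slice (y : Y) (ψ : L2 C) : L2 X :=
  ⟨fun x => ψ (e.symm (x, y)), mem_of_summable_normSq <|
    (hasSum_normSq ψ).summable.comp_injective
      (i := fun x => e.symm (x, y)) (fun a b h => by simpa using h)⟩

theorem hasSum_slice (ψ : L2 C) : HasSum (fun y => ‖slice e y ψ‖ ^ 2) (‖ψ‖ ^ 2) := by
  have h : HasSum (fun p : Y × X => ‖ψ (e.symm (p.2, p.1))‖ ^ 2) (‖ψ‖ ^ 2) :=
    ((Equiv.prodComm Y X).trans e.symm).hasSum_iff (f := fun c => ‖ψ c‖ ^ 2) |>.2 (hasSum_normSq ψ)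
  exact h.prod_fiberwise fun y => hasSum_normSq (slice e y ψ)

theorem cyl_summable (A : Op X) (ψ : L2 C) :
    Summable (fun p : Y × X => ‖A (slice e p.1 ψ) p.2‖ ^ 2) ∧
      ∑' p : Y × X, ‖A (slice e p.1 ψ) p.2‖ ^ 2 ≤ (‖A‖ * ‖ψ‖) ^ 2 := by
  have hle : ∀ y, ‖A (slice e y ψ)‖ ^ 2 ≤ ‖A‖ ^ 2 * ‖slice e y ψ‖ ^ 2 := fun y => by
    rw [← mul_pow]
    exact pow_le_pow_left₀ (norm_nonneg _) (A.le_opNorm _) 2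
  have hs := (hasSum_slice e ψ).mul_left (‖A‖ ^ 2)
  have hsum : Summable fun y => ‖A (slice e y ψ)‖ ^ 2 :=
    Summable.of_nonneg_of_le (fun _ => sq_nonneg _) hle hs.summable
  have hfib : ∀ y, ∑' x, ‖A (slice e y ψ) x‖ ^ 2 = ‖A (slice e y ψ)‖ ^ 2 := fun y =>
    (hasSum_normSq (A (slice e y ψ))).tsum_eq
  have key : Summable (fun p : Y × X => ‖A (slice e p.1 ψ) p.2‖ ^ 2) := by
    refine (summable_prod_of_nonneg (fun _ => sq_nonneg _)).2
      ⟨fun y => (hasSum_normSq (A (slice e y ψ))).summable, ?_⟩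
    exact hsum.congr fun y => (hfib y).symm
  refine ⟨key, ?_⟩
  rw [key.tsum_prod, mul_pow, ← hs.tsum_eq]
  exact (tsum_congr hfib).trans_le (hsum.tsum_le_tsum hle hs.summable)

theorem cyl_summable' (A : Op X) (ψ : L2 C) :
    HasSum (fun c => ‖A (slice e (e c).2 ψ) (e c).1‖ ^ 2)
      (∑' p : Y × X, ‖A (slice e p.1 ψ) p.2‖ ^ 2) :=
  (e.trans (Equiv.prodComm X Y)).hasSum_iff
    (f := fun p : Y × X => ‖A (slice e p.1 ψ) p.2‖ ^ 2) |>.2 (cyl_summable e A ψ).1.hasSum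

/-- The operator `A ⊗ I` on `L2 C`, where `A` acts on the first factor under the identification
`C ≃ X × Y` of basis labels: the component with second label `y` of `(A ⊗ I)ψ` is `A` applied to
the component of `ψ` with second label `y`. -/
noncomputable def tensorId (A : Op X) : Op C :=
  LinearMap.mkContinuous
    { toFun := fun ψ =>
        (⟨fun c => A (slice e (e c).2 ψ) (e c).1,
          mem_of_summable_normSq (cyl_summable' e A ψ).summable⟩ : L2 C)
      map_add' := fun ψ φ => by
        have h : ∀ y, slice e y (ψ + φ) = slice e y ψ + slice e y φ := fun y => rfl
        ext c
        simp only [h, map_add]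
        rfl
      map_smul' := fun a ψ => by
        have h : ∀ y, slice e y (a • ψ) = a • slice e y ψ := fun y => rfl
        ext c
        simp only [h, map_smul]
        rfl }
    ‖A‖ (fun ψ => by
      refine (sq_le_sq₀ (norm_nonneg _) (by positivity)).1 ?_
      refine le_trans (le_of_eq ?_) (cyl_summable e A ψ).2
      exact (hasSum_normSq _).unique (cyl_summable' e A ψ))

end Cylinder

/-! ### Quantum variables -/

/-- The types of quantum variables. -/
inductive QType where
  | boolean
  | integer

/-- Labels of the computational basis of the state space of a type. -/
def QType.Val : QType → Type
  | .boolean => Fin 2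
  | .integer => ℤ

instance : (t : QType) → Zero t.Val
  | .boolean => inferInstanceAs (Zero (Fin 2))
  | .integer => inferInstanceAs (Zero ℤ)

section Variables

variable {Var : Type u} (ty : Var → QType)

/-- Computational basis labels of the register formed by a finite set `X` of variables: the tensor
factors are indexed by the variables themselves. -/
abbrev RegBasis (X : Finset Var) : Type u := (q : X) → (ty q).Val

/-- Computational basis labels of the composite system of all variables: the product basis vectors
`⨂ |c q⟩_q` in which all but finitely many variables are in state `|0⟩`. -/
def Config : Type u := {c : (q : Var) → (ty q).Val // {q | c q ≠ 0}.Finite}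

/-- Computational basis labels of the composite system of the variables outside `X` (extended by
`0` on `X`). -/
def RestBasis (X : Finset Var) : Type u := {c : Config ty // ∀ q ∈ X, c.1 q = 0}

open Classical in
/-- A basis label of the whole system is a basis label of the register `X` together with a basis
label of the remaining variables. -/
noncomputable def splitConfig (X : Finset Var) : Config ty ≃ RegBasis ty X × RestBasis ty X where
  toFun c := (fun q => c.1 q,
    ⟨⟨fun q => if q ∈ X then 0 else c.1 q, c.2.subset fun q hq => by
      simp only [Set.mem_ofPred_eq] at hq ⊢
      split_ifs at hq <;> simp_all⟩, fun q hq => by simp [hq]⟩)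
  invFun p := ⟨fun q => if h : q ∈ X then p.1 ⟨q, h⟩ else p.2.1.1 q,
    (X.finite_toSet.union p.2.1.2).subset fun q hq => by
      by_cases h : q ∈ X
      · exact Or.inl h
      · right
        simpa [h] using hq⟩
  left_inv c := by
    apply Subtype.ext
    funext q
    by_cases h : q ∈ X <;> simp [h]
  right_inv p := by
    refine Prod.ext ?_ (Subtype.ext (Subtype.ext ?_))
    · funext q
      simp
    · funext q
      by_cases h : q ∈ X
      · simp [h, p.2.2 q h]
      · simp [h]

/-- Operators on the state space of the register `X`. -/
abbrev RegOp (X : Finset Var) : Type u := Op (RegBasis ty X)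

/-- Operators on the state space of all variables. -/
abbrev GlobalOp : Type u := Op (Config ty)

variable {ty}

/-- The cylinder extension `A ⊗ I` of an operator on a register to the whole system. -/
noncomputable def cyl {X : Finset Var} (A : RegOp ty X) : GlobalOp ty :=
  tensorId (splitConfig ty X) A

/-- `M` is a quantum measurement: `∑ₘ Mₘ† Mₘ = I`. -/
def IsMeasurement {X : Finset Var} {ι : Type} (M : ι → RegOp ty X) : Prop :=
  HasOpSum (fun m => adj (M m) * M m) 1

/-- The cylinder extension of `|x⟩_q⟨y|`, where `x` and `y` are basis labels of the state space of
the single variable `q`. -/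
noncomputable def varKetBra {q : Var} (x y : RegBasis ty {q}) : GlobalOp ty := cyl (ketBra x y)

/-- The effect `∑ₙ |0⟩_q⟨n| ρ |n⟩_q⟨0|` of `q := 0` on a state. -/
noncomputable def resetState (q : Var) (ρ : GlobalOp ty) : GlobalOp ty :=
  opSum fun n : RegBasis ty {q} => varKetBra 0 n * ρ * varKetBra n 0

/-! ### Quantum programs and their semantics -/

variable (ty)

/-- Quantum while-programs. -/
inductive Prog : Type (max u 1)
  /-- `skip` -/
  | skip : Prog
  /-- `q := 0` -/
  | reset (q : Var) : Prog
  /-- `X := U X` -/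
  | unitary (X : Finset Var) (U : RegOp ty X) (hU : adj U * U = 1) : Prog
  /-- `S₁; S₂` -/
  | seq (S₁ S₂ : Prog) : Prog
  /-- `measure M[X] : S`, with outcomes in an arbitrary set `ι` -/
  | measure (X : Finset Var) (ι : Type) (M : ι → RegOp ty X) (hM : IsMeasurement M)
      (S : ι → Prog) : Prog
  /-- `while M[X] = 1 do S` -/
  | loop (X : Finset Var) (M : Fin 2 → RegOp ty X) (hM : IsMeasurement M) (S : Prog) : Prog

/-- Configurations `⟨S, ρ⟩`, with `none` for the empty program `E`. The rules
below make sense for an arbitrary operator `ρ`; correctness only uses runs that start in a partial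
density operator, and these stay among the partial density operators. -/
abbrev Conf : Type (max u 1) := Option (Prog ty) × GlobalOp ty

variable {ty}

/-- The one-step transitions between configurations. This is a family of types, not of
propositions: different outcomes of a measurement are different transitions, even if they lead to
the same configuration. -/
inductive Step : Conf ty → Conf ty → Type (max u 1)
  | skip (ρ : GlobalOp ty) : Step (some .skip, ρ) (none, ρ)
  | reset (q : Var) (ρ : GlobalOp ty) : Step (some (.reset q), ρ) (none, resetState q ρ)
  | unitary (X : Finset Var) (U : RegOp ty X) (hU : adj U * U = 1) (ρ : GlobalOp ty) :
      Step (some (.unitary X U hU), ρ) (none, cyl U * ρ * adj (cyl U))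
  | seq {S₁ S₁' : Prog ty} {ρ ρ' : GlobalOp ty} (S₂ : Prog ty)
      (s : Step (some S₁, ρ) (some S₁', ρ')) :
      Step (some (.seq S₁ S₂), ρ) (some (.seq S₁' S₂), ρ')
  | seqEnd {S₁ : Prog ty} {ρ ρ' : GlobalOp ty} (S₂ : Prog ty)
      (s : Step (some S₁, ρ) (none, ρ')) :
      Step (some (.seq S₁ S₂), ρ) (some S₂, ρ')
  | measure (X : Finset Var) (ι : Type) (M : ι → RegOp ty X) (hM : IsMeasurement M)
      (S : ι → Prog ty) (m : ι) (ρ : GlobalOp ty) :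
      Step (some (.measure X ι M hM S), ρ) (some (S m), cyl (M m) * ρ * adj (cyl (M m)))
  | loop0 (X : Finset Var) (M : Fin 2 → RegOp ty X) (hM : IsMeasurement M) (S : Prog ty)
      (ρ : GlobalOp ty) :
      Step (some (.loop X M hM S), ρ) (none, cyl (M 0) * ρ * adj (cyl (M 0)))
  | loop1 (X : Finset Var) (M : Fin 2 → RegOp ty X) (hM : IsMeasurement M) (S : Prog ty)
      (ρ : GlobalOp ty) :
      Step (some (.loop X M hM S), ρ)
        (some (.seq S (.loop X M hM S)), cyl (M 1) * ρ * adj (cyl (M 1)))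

/-- Finite transition sequences. -/
inductive Run : Conf ty → Conf ty → Type (max u 1)
  | refl (a : Conf ty) : Run a a
  | head {a b c : Conf ty} (s : Step a b) (r : Run b c) : Run a c

/-- The semantic function `[|S|]`: the sum of the results of all terminating computations of `S`
from `ρ`, one summand for each computation. -/
noncomputable def denote (S : Prog ty) (ρ : GlobalOp ty) : GlobalOp ty :=
  opSum fun r : (Σ ρ' : GlobalOp ty, Run (some S, ρ) (none, ρ')) => r.1

/-! ### Correctness formulas and the proof system -/

variable (ty)

/-- Quantum predicates on the whole system: operators between `0` and `I` in the Löwner order (which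
is the order of Mathlib on bounded operators: `A ≤ B` iff `B - A` is positive). -/
def QPred : Type u := {P : GlobalOp ty // 0 ≤ P ∧ P ≤ 1}

variable {ty}

/-- The formula `{P} S {Q}` is true in the sense of partial correctness. All the traces are real
numbers. -/
def ParCorrect (P : QPred ty) (S : Prog ty) (Q : QPred ty) : Prop :=
  ∀ ρ : GlobalOp ty, IsPartialDensity ρ →
    (trace (P.1 * ρ)).re ≤
      (trace (Q.1 * denote S ρ)).re + ((trace ρ).re - (trace (denote S ρ)).re)

/-- Provability of `{P} S {Q}` in the proof system `qPD`. -/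
inductive Provable : QPred ty → Prog ty → QPred ty → Prop
  | skip (P : QPred ty) : Provable P .skip P
  | reset (q : Var) (P P' : QPred ty)
      (h : HasOpSum (fun n : RegBasis ty {q} => varKetBra n 0 * P.1 * varKetBra 0 n) P'.1) :
      Provable P' (.reset q) P
  | unitary (X : Finset Var) (U : RegOp ty X) (hU : adj U * U = 1) (P P' : QPred ty)
      (h : P'.1 = adj (cyl U) * P.1 * cyl U) :
      Provable P' (.unitary X U hU) P
  | seq {S₁ S₂ : Prog ty} {P Q R : QPred ty} (h₁ : Provable P S₁ Q) (h₂ : Provable Q S₂ R) :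
      Provable P (.seq S₁ S₂) R
  | measure (X : Finset Var) (ι : Type) (M : ι → RegOp ty X) (hM : IsMeasurement M)
      (S : ι → Prog ty) (P : ι → QPred ty) (P' Q : QPred ty)
      (h : ∀ m, Provable (P m) (S m) Q)
      (hP' : HasOpSum (fun m => adj (cyl (M m)) * (P m).1 * cyl (M m)) P'.1) :
      Provable P' (.measure X ι M hM S) Q
  | loop (X : Finset Var) (M : Fin 2 → RegOp ty X) (hM : IsMeasurement M) (S : Prog ty)
      (P Q R : QPred ty)
      (hR : R.1 = adj (cyl (M 0)) * P.1 * cyl (M 0) + adj (cyl (M 1)) * Q.1 * cyl (M 1))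
      (h : Provable Q S R) :
      Provable R (.loop X M hM S) P
  | order {S : Prog ty} {P P' Q Q' : QPred ty} (hP : P.1 ≤ P'.1) (h : Provable P' S Q')
      (hQ : Q'.1 ≤ Q.1) :
      Provable P S Q

end Variables

end QuantumWhile

open QuantumWhile

/-! Partial correctness loses the mass of diverging computations, so it is best read through
complements. Write S* for the dual of the semantic function, so that tr(S*(B)ρ) = tr(B⟦S⟧(ρ)). With
B = I - Q, the inequality defining partial correctness rearranges to tr(Pρ) ≤ tr((I - S*(B))ρ).
Tested on pure states, this says P ⊑ I - S*(I - Q). The operator on the right is the weakest liberal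
precondition, and the order rule reduces completeness to deriving it.

`exists_isDual` builds S*(B) by structural induction, together with a derivation of {I - S*(B)} S {I
- B}. Every atomic action is a Kraus family with ∑ K†K = I, so the rules, which act on preconditions
by B ↦ ∑ K†BK, commute with complementation (`IsKraus.exists_dual`). For a loop, S*(B) is the limit
of the increasing iterates from 0 of V ↦ M₀†BM₀ + M₁†S*(V)M₁, with S the body
(`exists_isDual_loop`). The limit is a fixed point, which is exactly the premise of the loop rule
after complementation.

All expectations are values in [0, ∞] of `pairing`, the squared Hilbert-Schmidt norm of √A√ρ. Sums
over computations therefore need no convergence argument and commute with suprema of increasing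
sequences. `trace_mul_re` and `denote_posTraceClass` connect these values with the traces and the
semantic function. -/

namespace QuantumWhile

/-! ### Quadratic forms of positive operators -/

section Quad

set_option linter.unusedSectionVars false

variable {H : Type*} [NormedAddCommGroup H] [InnerProductSpace ℂ H] [CompleteSpace H]

/-- The quadratic form of an operator, with values in the extended nonnegative reals. -/
noncomputable def quad (A : H →L[ℂ] H) (φ : H) : ℝ≥0∞ := ENNReal.ofReal (inner ℂ φ (A φ)).re

theorem re_inner_nonneg {A : H →L[ℂ] H} (hA : 0 ≤ A) (φ : H) : 0 ≤ (inner ℂ φ (A φ)).re :=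
  ((ContinuousLinearMap.nonneg_iff_isPositive A).1 hA).re_inner_nonneg_right φ

/-- The positive square root of a positive operator. -/
noncomputable def sqrtOp (A : H →L[ℂ] H) : H →L[ℂ] H := CFC.sqrt A

theorem sqrtOp_mul_self {A : H →L[ℂ] H} (hA : 0 ≤ A) : sqrtOp A * sqrtOp A = A :=
  CFC.sqrt_mul_sqrt_self A hA

theorem sqrtOp_apply_apply {A : H →L[ℂ] H} (hA : 0 ≤ A) (φ : H) :
    sqrtOp A (sqrtOp A φ) = A φ :=
  congrArg (fun B : H →L[ℂ] H => B φ) (sqrtOp_mul_self hA)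

theorem adjoint_sqrtOp (A : H →L[ℂ] H) :
    ContinuousLinearMap.adjoint (sqrtOp A) = sqrtOp A :=
  (IsSelfAdjoint.of_nonneg (CFC.sqrt_nonneg A)).star_eq

theorem re_inner_eq_sqrt {A : H →L[ℂ] H} (hA : 0 ≤ A) (φ : H) :
    (inner ℂ φ (A φ)).re = ‖sqrtOp A φ‖ ^ 2 := by
  rw [← sqrtOp_apply_apply hA, ← ContinuousLinearMap.adjoint_inner_left, adjoint_sqrtOp]
  exact inner_self_eq_norm_sq (𝕜 := ℂ) _

theorem ofReal_norm_sq {E : Type*} [SeminormedAddCommGroup E] (φ : E) :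
    ENNReal.ofReal (‖φ‖ ^ 2) = ‖φ‖ₑ ^ 2 := by
  rw [ENNReal.ofReal_pow (norm_nonneg _), ofReal_norm]

theorem quad_eq_sqrt {A : H →L[ℂ] H} (hA : 0 ≤ A) (φ : H) :
    quad A φ = ‖sqrtOp A φ‖ₑ ^ 2 := by
  rw [quad, re_inner_eq_sqrt hA, ofReal_norm_sq]

theorem quad_one (φ : H) : quad 1 φ = ‖φ‖ₑ ^ 2 := by
  rw [quad, ← ofReal_norm_sq]
  congr 1
  exact inner_self_eq_norm_sq (𝕜 := ℂ) φ

theorem quad_add {A B : H →L[ℂ] H} (hA : 0 ≤ A) (hB : 0 ≤ B) (φ : H) :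
    quad (A + B) φ = quad A φ + quad B φ := by
  rw [quad, add_apply, inner_add_right, Complex.add_re,
    ENNReal.ofReal_add (re_inner_nonneg hA φ) (re_inner_nonneg hB φ)]
  rfl

theorem quad_conj (M A : H →L[ℂ] H) (φ : H) :
    quad (ContinuousLinearMap.adjoint M * A * M) φ = quad A (M φ) := by
  simp only [quad, mul_apply_eq_comp, ContinuousLinearMap.adjoint_inner_right]

theorem quad_sum {ι : Type*} {A : ι → H →L[ℂ] H} (hA : ∀ i, 0 ≤ A i) (s : Finset ι) (φ : H) :
    quad (∑ i ∈ s, A i) φ = ∑ i ∈ s, quad (A i) φ := by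
  rw [quad, sum_apply, inner_sum, Complex.re_sum,
    ENNReal.ofReal_sum_of_nonneg fun i _ => re_inner_nonneg (hA i) φ]
  rfl

theorem le_of_quad_le {A B : H →L[ℂ] H} (hA : 0 ≤ A) (hB : 0 ≤ B)
    (h : ∀ φ, quad A φ ≤ quad B φ) : A ≤ B := by
  rw [ContinuousLinearMap.le_def, ContinuousLinearMap.isPositive_def']
  refine ⟨(IsSelfAdjoint.of_nonneg hB).sub (IsSelfAdjoint.of_nonneg hA), fun φ => ?_⟩
  have := (ENNReal.ofReal_le_ofReal_iff (re_inner_nonneg hB φ)).1 (h φ)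
  rw [ContinuousLinearMap.reApplyInnerSelf_apply, ← inner_re_symm, sub_apply,
    inner_sub_right]
  simpa using this

theorem quad_mono {A B : H →L[ℂ] H} (h : A ≤ B) (φ : H) : quad A φ ≤ quad B φ := by
  have := re_inner_nonneg (sub_nonneg.2 h) φ
  rw [sub_apply, inner_sub_right, Complex.sub_re, sub_nonneg] at this
  exact ENNReal.ofReal_le_ofReal this

theorem eq_of_quad_eq {A B : H →L[ℂ] H} (hA : 0 ≤ A) (hB : 0 ≤ B)
    (h : ∀ φ, quad A φ = quad B φ) : A = B :=
  le_antisymm (le_of_quad_le hA hB fun φ => (h φ).le) (le_of_quad_le hB hA fun φ => (h φ).ge)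

theorem norm_sqrt_mul_self {A : H →L[ℂ] H} (hA : 0 ≤ A) :
    ‖sqrtOp A‖ * ‖sqrtOp A‖ = ‖A‖ := by
  rw [← CStarRing.norm_star_mul_self, ContinuousLinearMap.star_eq_adjoint, adjoint_sqrtOp,
    sqrtOp_mul_self hA]

/-- Factor A = √A√A and bound only the outer root by its norm. This turns convergence of quadratic
forms into convergence on vectors. -/
theorem norm_sq_apply_le {A : H →L[ℂ] H} (hA : 0 ≤ A) (φ : H) :
    ‖A φ‖ ^ 2 ≤ ‖A‖ * (inner ℂ φ (A φ)).re := by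
  have hn := norm_sqrt_mul_self hA
  rw [re_inner_eq_sqrt hA, ← hn, ← sqrtOp_apply_apply hA φ]
  calc ‖sqrtOp A (sqrtOp A φ)‖ ^ 2 ≤ (‖sqrtOp A‖ * ‖sqrtOp A φ‖) ^ 2 :=
        pow_le_pow_left₀ (norm_nonneg _) (ContinuousLinearMap.le_opNorm _ _) 2
    _ = _ := by ring

theorem norm_le_of_quad_le {A : H →L[ℂ] H} (hA : 0 ≤ A) {C : ℝ} (hC : 0 ≤ C)
    (h : ∀ φ, (inner ℂ φ (A φ)).re ≤ C * ‖φ‖ ^ 2) : ‖A‖ ≤ C := by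
  have hn := norm_sqrt_mul_self hA
  have hs : ‖sqrtOp A‖ ≤ √C := by
    refine ContinuousLinearMap.opNorm_le_bound _ (Real.sqrt_nonneg _) fun φ => ?_
    refine (sq_le_sq₀ (norm_nonneg _) (by positivity)).1 ?_
    rw [← re_inner_eq_sqrt hA, mul_pow, Real.sq_sqrt hC]
    exact h φ
  calc ‖A‖ = ‖sqrtOp A‖ * ‖sqrtOp A‖ := hn.symm
    _ ≤ √C * √C := mul_self_le_mul_self (norm_nonneg _) hs
    _ = C := Real.mul_self_sqrt hC

/-- The quadratic form of a convergent sum of positive operators. -/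
theorem quad_hasSum {ι : Type*} {A : ι → H →L[ℂ] H} {W : H →L[ℂ] H} (hA : ∀ i, 0 ≤ A i) {φ : H}
    (h : HasSum (fun i => A i φ) (W φ)) : quad W φ = ∑' i, quad (A i) φ := by
  have h1 : HasSum (fun i => inner ℂ φ (A i φ)) (inner ℂ φ (W φ)) :=
    h.mapL (innerSL ℂ φ)
  have h2 := Complex.hasSum_re h1
  rw [quad, ← h2.tsum_eq, ENNReal.ofReal_tsum_of_nonneg (fun i => re_inner_nonneg (hA i) φ)
    h2.summable]
  rfl

open ComplexOrder in
/-- A family of positive operators whose quadratic forms are uniformly summable is summable. -/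
theorem exists_hasSum_of_quad_le {ι : Type*} {A : ι → H →L[ℂ] H} (hA : ∀ i, 0 ≤ A i) {C : ℝ}
    (hC : 0 ≤ C) (h : ∀ φ, ∑' i, quad (A i) φ ≤ ENNReal.ofReal (C * ‖φ‖ ^ 2)) :
    ∃ W : H →L[ℂ] H, 0 ≤ W ∧ ∀ φ, HasSum (fun i => A i φ) (W φ) := by
  have hpos : ∀ s : Finset ι, 0 ≤ ∑ i ∈ s, A i := fun s => Finset.sum_nonneg fun i _ => hA i
  have hnorm : ∀ s : Finset ι, ‖∑ i ∈ s, A i‖ ≤ C := fun s => by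
    refine norm_le_of_quad_le (hpos s) hC fun φ => ?_
    rw [← ENNReal.ofReal_le_ofReal_iff (by positivity)]
    have := quad_sum hA s φ
    rw [quad] at this
    rw [this]
    exact (ENNReal.sum_le_tsum s).trans (h φ)
  have hsum : ∀ φ, Summable fun i => A i φ := fun φ => by
    have hre : Summable fun i => (inner ℂ φ (A i φ)).re := by
      have hne : ∑' i, quad (A i) φ ≠ ⊤ := ((h φ).trans_lt ENNReal.ofReal_lt_top).ne
      refine (ENNReal.summable_toReal hne).congr fun i => ?_
      rw [quad, ENNReal.toReal_ofReal (re_inner_nonneg (hA i) φ)]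
    rw [summable_iff_vanishing_norm] at hre ⊢
    intro ε hε
    -- By `norm_sq_apply_le`, the squared norm of a tail is at most C times the tail of the
    -- quadratic forms. The denominator C + 1 keeps the threshold meaningful when C = 0.
    obtain ⟨s, hs⟩ := hre (ε ^ 2 / (C + 1)) (by positivity)
    refine ⟨s, fun t ht => ?_⟩
    have h1 := hs t ht
    have h2 := norm_sq_apply_le (hpos t) φ
    rw [sum_apply, inner_sum, Complex.re_sum] at h2
    rw [Real.norm_eq_abs, abs_of_nonneg (Finset.sum_nonneg fun i _ => re_inner_nonneg (hA i) φ),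
      lt_div_iff₀ (by positivity)] at h1
    refine lt_of_pow_lt_pow_left₀ 2 hε.le ?_
    have h3 : 0 ≤ ∑ i ∈ t, (inner ℂ φ (A i φ)).re :=
      Finset.sum_nonneg fun i _ => re_inner_nonneg (hA i) φ
    nlinarith [hnorm t]
  have hle : ∀ φ, ‖∑' i, A i φ‖ ≤ C * ‖φ‖ := fun φ => by
    refine le_of_tendsto (hsum φ).hasSum.norm (Filter.Eventually.of_forall fun s => ?_)
    rw [← sum_apply]
    exact (ContinuousLinearMap.le_opNorm _ _).trans
      (mul_le_mul_of_nonneg_right (hnorm s) (norm_nonneg _))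
  let W : H →L[ℂ] H := LinearMap.mkContinuous
    { toFun := fun φ => ∑' i, A i φ
      map_add' := fun φ ψ => by
        simp only [map_add]
        exact (hsum φ).tsum_add (hsum ψ)
      map_smul' := fun a φ => by
        simp only [map_smul]
        exact (hsum φ).tsum_const_smul a } C hle
  have hW : ∀ φ, HasSum (fun i => A i φ) (W φ) := fun φ => (hsum φ).hasSum
  refine ⟨W, ?_, hW⟩
  rw [ContinuousLinearMap.nonneg_iff_isPositive, ContinuousLinearMap.isPositive_iff_complex]
  intro φ
  have h1 : HasSum (fun i => inner ℂ (A i φ) φ) (inner ℂ (W φ) φ) := by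
    have := Complex.hasSum_conj'.2 ((hW φ).mapL (innerSL ℂ φ))
    simpa using this
  have h2 : ∀ i, 0 ≤ inner ℂ (A i φ) φ := fun i =>
    ((ContinuousLinearMap.nonneg_iff_isPositive _).1 (hA i)).inner_nonneg_left φ
  have h3 : 0 ≤ inner ℂ (W φ) φ := h1.nonneg h2
  rw [Complex.nonneg_iff] at h3
  exact ⟨by apply Complex.ext <;> simp [h3.2.symm], h3.1⟩

/-- A family of positive operators converges to `W` if its quadratic forms do. -/
theorem hasSum_of_quad_eq {ι : Type*} {A : ι → H →L[ℂ] H} {W : H →L[ℂ] H} (hA : ∀ i, 0 ≤ A i)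
    (hW : 0 ≤ W) (h : ∀ φ, quad W φ = ∑' i, quad (A i) φ) (φ : H) :
    HasSum (fun i => A i φ) (W φ) := by
  -- Some sum W' exists because the forms are dominated by that of W; it equals W since a positive
  -- operator is determined by its quadratic form.
  obtain ⟨W', hW', hs⟩ := exists_hasSum_of_quad_le hA (C := ‖W‖) (norm_nonneg _) fun φ => by
    rw [← h]
    refine ENNReal.ofReal_le_ofReal ((Complex.re_le_norm _).trans ((norm_inner_le_norm _ _).trans ?_))
    calc ‖φ‖ * ‖W φ‖ ≤ ‖φ‖ * (‖W‖ * ‖φ‖) := by gcongr; exact W.le_opNorm φ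
      _ = _ := by ring
  rw [eq_of_quad_eq hW hW' fun φ => (h φ).trans (quad_hasSum hA (hs φ)).symm]
  exact hs φ

theorem conj_nonneg {A : H →L[ℂ] H} (hA : 0 ≤ A) (M : H →L[ℂ] H) :
    0 ≤ ContinuousLinearMap.adjoint M * A * M :=
  star_left_conjugate_nonneg hA M

theorem conj_nonneg' {A : H →L[ℂ] H} (hA : 0 ≤ A) (M : H →L[ℂ] H) :
    0 ≤ M * A * ContinuousLinearMap.adjoint M :=
  star_right_conjugate_nonneg hA M

theorem enorm_inner_le (x y : H) : ‖(inner ℂ x y : ℂ)‖ₑ ≤ ‖x‖ₑ * ‖y‖ₑ := by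
  rw [← ofReal_norm, ← ofReal_norm, ← ofReal_norm, ← ENNReal.ofReal_mul (norm_nonneg _)]
  exact ENNReal.ofReal_le_ofReal (norm_inner_le_norm x y)

theorem adjoint_mul_self_nonneg (M : H →L[ℂ] H) : 0 ≤ ContinuousLinearMap.adjoint M * M :=
  star_mul_self_nonneg M

end Quad

/-! ### Hilbert-Schmidt norm and trace pairing -/

section Trace

variable {C : Type*}

theorem inner_ket (c : C) (φ : L2 C) : inner ℂ (ket c) φ = φ c := by
  classical
  rw [ket, lp.inner_single_left]
  simp

theorem enorm_sq_eq_tsum (φ : L2 C) : ‖φ‖ₑ ^ 2 = ∑' c, ‖φ c‖ₑ ^ 2 := by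
  rw [← ofReal_norm_sq, ← (hasSum_normSq φ).tsum_eq,
    ENNReal.ofReal_tsum_of_nonneg (fun _ => sq_nonneg _) (hasSum_normSq φ).summable]
  simp only [ofReal_norm_sq]

theorem norm_ket (c : C) : ‖(ket c : L2 C)‖ = 1 := by
  classical
  rw [ket, lp.norm_single (by norm_num)]
  simp

/-- The square of the Hilbert-Schmidt norm. -/
noncomputable def hsNormSq (X : Op C) : ℝ≥0∞ := ∑' c, ‖X (ket c)‖ₑ ^ 2

theorem hsNormSq_adj (X : Op C) : hsNormSq (adj X) = hsNormSq X := by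
  simp only [hsNormSq, enorm_sq_eq_tsum]
  rw [ENNReal.tsum_comm]
  refine tsum_congr fun c => tsum_congr fun d => ?_
  rw [← inner_ket, ← inner_ket, ContinuousLinearMap.adjoint_inner_right, ← inner_conj_symm,
    RCLike.enorm_conj]

/-- The trace of the product of two positive operators, in the extended nonnegative reals. -/
noncomputable def pairing (A ρ : Op C) : ℝ≥0∞ := ∑' c, quad A (sqrtOp ρ (ket c))

theorem pairing_eq_hsNormSq {A : Op C} (hA : 0 ≤ A) (ρ : Op C) :
    pairing A ρ = hsNormSq (sqrtOp A * sqrtOp ρ) :=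
  tsum_congr fun _ => quad_eq_sqrt hA _

/-- √A√ρ and √ρ√A are adjoint to each other, and the adjoint has the same Hilbert-Schmidt norm. No
trace-class assumption is needed. -/
theorem pairing_comm {A ρ : Op C} (hA : 0 ≤ A) (hρ : 0 ≤ ρ) : pairing A ρ = pairing ρ A := by
  rw [pairing_eq_hsNormSq hA, pairing_eq_hsNormSq hρ, ← hsNormSq_adj]
  congr 1
  exact (star_mul _ _).trans (congrArg₂ _ (adjoint_sqrtOp ρ) (adjoint_sqrtOp A))

/-- Both sides are squared Hilbert-Schmidt norms, of √A M √ρ and of its adjoint. This is the duality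
between transforming states and transforming predicates. -/
theorem pairing_conj {A ρ : Op C} (hA : 0 ≤ A) (hρ : 0 ≤ ρ) (M : Op C) :
    pairing (adj M * A * M) ρ = pairing A (M * ρ * adj M) := by
  rw [pairing_comm hA (conj_nonneg' hρ M)]
  have h1 : pairing (adj M * A * M) ρ = hsNormSq (sqrtOp A * M * sqrtOp ρ) :=
    tsum_congr fun c => by rw [quad_conj, quad_eq_sqrt hA]; rfl
  have h2 : pairing (M * ρ * adj M) A = hsNormSq (sqrtOp ρ * adj M * sqrtOp A) :=
    tsum_congr fun c => by
      have := quad_conj (adj M) ρ (sqrtOp A (ket c))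
      rw [ContinuousLinearMap.adjoint_adjoint] at this
      rw [this, quad_eq_sqrt hρ]; rfl
  rw [h1, h2, ← hsNormSq_adj]
  congr 1
  calc star (sqrtOp A * M * sqrtOp ρ)
      = star (sqrtOp ρ) * (star M * star (sqrtOp A)) := by rw [star_mul, star_mul]
    _ = sqrtOp ρ * (star M * sqrtOp A) :=
        congrArg₂ _ (adjoint_sqrtOp ρ) (congrArg _ (adjoint_sqrtOp A))
    _ = _ := (mul_assoc _ _ _).symm

theorem pairing_mono {A B : Op C} (h : A ≤ B) (ρ : Op C) : pairing A ρ ≤ pairing B ρ :=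
  ENNReal.tsum_le_tsum fun _ => quad_mono h _

theorem pairing_add {A B : Op C} (hA : 0 ≤ A) (hB : 0 ≤ B) (ρ : Op C) :
    pairing (A + B) ρ = pairing A ρ + pairing B ρ := by
  simp only [pairing, quad_add hA hB]
  exact ENNReal.tsum_add

theorem pairing_zero (ρ : Op C) : pairing 0 ρ = 0 := by
  simp [pairing, quad]

theorem pairing_hasOpSum_left {ι : Type*} {A : ι → Op C} {W : Op C} (hA : ∀ i, 0 ≤ A i)
    (h : HasOpSum A W) (ρ : Op C) : pairing W ρ = ∑' i, pairing (A i) ρ := by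
  simp only [pairing, quad_hasSum hA (h _)]
  exact ENNReal.tsum_comm

theorem pairing_hasOpSum_right {ι : Type*} {ρ : ι → Op C} {σ A : Op C} (hA : 0 ≤ A)
    (hρ : ∀ i, 0 ≤ ρ i) (hσ : 0 ≤ σ) (h : HasOpSum ρ σ) :
    pairing A σ = ∑' i, pairing A (ρ i) := by
  rw [pairing_comm hA hσ, pairing_hasOpSum_left hρ h]
  exact tsum_congr fun i => pairing_comm (hρ i) hA

/-- The operator `|φ⟩⟨φ|`. -/
noncomputable def proj (φ : L2 C) : Op C := (innerSL ℂ φ).smulRight φ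

theorem proj_apply (φ ψ : L2 C) : proj φ ψ = (inner ℂ φ ψ : ℂ) • φ := rfl

theorem inner_proj (φ ψ : L2 C) : inner ℂ ψ (proj φ ψ) = ((‖inner ℂ φ ψ‖ ^ 2 : ℝ) : ℂ) := by
  rw [proj_apply, inner_smul_right, ← inner_conj_symm ψ φ, Complex.mul_conj, Complex.normSq_eq_norm_sq]

theorem proj_isPositive (φ : L2 C) : (proj φ).IsPositive := by
  rw [ContinuousLinearMap.isPositive_iff_complex]
  intro ψ
  have h : inner ℂ (proj φ ψ) ψ = ((‖inner ℂ φ ψ‖ ^ 2 : ℝ) : ℂ) := by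
    rw [← inner_conj_symm, inner_proj, Complex.conj_ofReal]
  rw [h]
  exact ⟨rfl, sq_nonneg _⟩

theorem proj_nonneg (φ : L2 C) : 0 ≤ proj φ :=
  (ContinuousLinearMap.nonneg_iff_isPositive _).2 (proj_isPositive φ)

theorem quad_proj (φ ψ : L2 C) : quad (proj φ) ψ = ‖inner ℂ φ ψ‖ₑ ^ 2 := by
  rw [quad, inner_proj, Complex.ofReal_re, ofReal_norm_sq]

theorem pairing_proj {A : Op C} (hA : 0 ≤ A) (φ : L2 C) : pairing A (proj φ) = quad A φ := by
  rw [pairing_comm hA (proj_nonneg φ), quad_eq_sqrt hA, enorm_sq_eq_tsum, pairing]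
  refine tsum_congr fun c => ?_
  rw [quad_proj, ← inner_ket, ← ContinuousLinearMap.adjoint_inner_left, adjoint_sqrtOp,
    ← inner_conj_symm, RCLike.enorm_conj]

theorem eq_of_pairing_eq {A B : Op C} (hA : 0 ≤ A) (hB : 0 ≤ B)
    (h : ∀ φ, pairing A (proj φ) = pairing B (proj φ)) : A = B :=
  eq_of_quad_eq hA hB fun φ => by rw [← pairing_proj hA, ← pairing_proj hB, h]

theorem le_of_pairing_le {A B : Op C} (hA : 0 ≤ A) (hB : 0 ≤ B)
    (h : ∀ φ, pairing A (proj φ) ≤ pairing B (proj φ)) : A ≤ B :=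
  le_of_quad_le hA hB fun φ => by rw [← pairing_proj hA, ← pairing_proj hB]; exact h φ

theorem pairing_one_proj (φ : L2 C) : pairing 1 (proj φ) = ‖φ‖ₑ ^ 2 := by
  rw [pairing_proj zero_le_one, quad_one]

/-- Cauchy-Schwarz in each term of ∑ |⟨φ, √σ c⟩|². Summable traces thus give the uniform bound
needed to sum operators. -/
theorem quad_le_pairing_one {σ : Op C} (hσ : 0 ≤ σ) (φ : L2 C) :
    quad σ φ ≤ pairing 1 σ * ‖φ‖ₑ ^ 2 := by
  rw [← pairing_proj hσ, pairing_comm hσ (proj_nonneg φ), pairing, pairing, ← ENNReal.tsum_mul_right]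
  refine ENNReal.tsum_le_tsum fun c => ?_
  rw [quad_proj, quad_one, ← mul_pow, mul_comm]
  gcongr
  exact enorm_inner_le _ _

/-- Positive trace-class operators. -/
structure PosTraceClass (ρ : Op C) : Prop where
  nonneg : 0 ≤ ρ
  pairing_ne_top : pairing 1 ρ ≠ ⊤

theorem hasOpSum_opSum {ι : Type*} {f : ι → Op C} {A : Op C} (h : HasOpSum f A) :
    HasOpSum f (opSum f) := by
  have h' : ∃ A, HasOpSum f A := ⟨A, h⟩
  rw [opSum, dif_pos h']
  exact h'.choose_spec

theorem hasOpSum_unique {ι : Type*} {f : ι → Op C} {A B : Op C} (hA : HasOpSum f A)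
    (hB : HasOpSum f B) : A = B :=
  ContinuousLinearMap.ext fun ψ => (hA ψ).unique (hB ψ)

/-- A family of positive operators with summable traces is summable. -/
theorem hasOpSum_of_pairing_ne_top {ι : Type*} {ρ : ι → Op C} (hρ : ∀ i, 0 ≤ ρ i)
    (h : ∑' i, pairing 1 (ρ i) ≠ ⊤) : 0 ≤ opSum ρ ∧ HasOpSum ρ (opSum ρ) := by
  obtain ⟨W, hW, hs⟩ := exists_hasSum_of_quad_le hρ (C := (∑' i, pairing 1 (ρ i)).toReal)
    ENNReal.toReal_nonneg fun φ => by
      rw [ENNReal.ofReal_mul ENNReal.toReal_nonneg, ENNReal.ofReal_toReal h, ofReal_norm_sq,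
        ← ENNReal.tsum_mul_right]
      exact ENNReal.tsum_le_tsum fun i => quad_le_pairing_one (hρ i) φ
  have h2 := hasOpSum_opSum (A := W) hs
  refine ⟨?_, h2⟩
  rw [hasOpSum_unique h2 hs]
  exact hW

theorem pairing_opSum {ι : Type*} {ρ : ι → Op C} (hρ : ∀ i, 0 ≤ ρ i)
    (h : ∑' i, pairing 1 (ρ i) ≠ ⊤) {A : Op C} (hA : 0 ≤ A) :
    pairing A (opSum ρ) = ∑' i, pairing A (ρ i) :=
  have h1 := hasOpSum_of_pairing_ne_top hρ h
  pairing_hasOpSum_right hA hρ h1.1 h1.2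

theorem summable_hsNormSq {X : Op C} (h : hsNormSq X ≠ ⊤) :
    Summable fun p : C × C => ‖X (ket p.1) p.2‖ ^ 2 := by
  have h1 : hsNormSq X = ∑' p : C × C, ‖X (ket p.1) p.2‖ₑ ^ 2 := by
    rw [ENNReal.tsum_prod' (f := fun p : C × C => ‖X (ket p.1) p.2‖ₑ ^ 2)]
    exact tsum_congr fun c => enorm_sq_eq_tsum _
  rw [h1] at h
  refine (ENNReal.summable_toReal h).congr fun p => ?_
  rw [← ofReal_norm_sq, ENNReal.toReal_ofReal (sq_nonneg _)]

theorem hsNormSq_sqrt (σ : Op C) : hsNormSq (sqrtOp σ) = pairing 1 σ :=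
  tsum_congr fun _ => (quad_one _).symm

/-- The trace pairing computes the trace of the product. -/
theorem trace_mul_re {A σ : Op C} (hA : 0 ≤ A) (hσ : PosTraceClass σ) :
    (trace (A * σ)).re = (pairing A σ).toReal := by
  set R := sqrtOp σ with hR
  have hR0 : hsNormSq R ≠ ⊤ := by rw [hR, hsNormSq_sqrt]; exact hσ.2
  have hAR : hsNormSq (A * R) ≠ ⊤ := by
    refine ne_top_of_le_ne_top (ENNReal.mul_ne_top (a := ‖A‖ₑ ^ 2) (by simp) hR0) ?_
    rw [hsNormSq, hsNormSq, ← ENNReal.tsum_mul_left]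
    refine ENNReal.tsum_le_tsum fun c => ?_
    rw [← mul_pow]
    gcongr
    exact A.le_opENorm _
  have hRadj : ∀ c d, inner ℂ (R (ket d)) (ket c) = R (ket c) d := fun c d => by
    rw [← inner_ket, ← ContinuousLinearMap.adjoint_inner_right, hR, adjoint_sqrtOp]
  -- With R = √σ, both AR and R are Hilbert-Schmidt, so the double sum for tr(ARR) converges
  -- absolutely. Exchanging its order gives tr(RAR).
  have hs : Summable (Function.uncurry fun c d => (A * R) (ket d) c * R (ket c) d) := by
    have h1 := summable_hsNormSq hR0
    have h2 := ((Equiv.prodComm C C).summable_iff).2 (summable_hsNormSq hAR)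
    refine Summable.of_norm_bounded (h1.add h2) fun p => ?_
    rw [Function.uncurry, norm_mul]
    change _ ≤ ‖R (ket p.1) p.2‖ ^ 2 + ‖(A * R) (ket p.2) p.1‖ ^ 2
    nlinarith [sq_nonneg (‖R (ket p.1) p.2‖ - ‖(A * R) (ket p.2) p.1‖),
      norm_nonneg (R (ket p.1) p.2), norm_nonneg ((A * R) (ket p.2) p.1)]
  have h1 : ∀ c, inner ℂ (ket c) ((A * σ) (ket c)) = ∑' d, (A * R) (ket d) c * R (ket c) d := by
    intro c
    have e : (A * σ) (ket c) = (A * R) (R (ket c)) := by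
      conv_lhs => rw [← sqrtOp_mul_self hσ.1]
      rfl
    rw [e, ← ContinuousLinearMap.adjoint_inner_left, ← (lp.hasSum_inner _ _).tsum_eq]
    refine tsum_congr fun d => ?_
    rw [← inner_ket d (adj (A * R) (ket c)), ContinuousLinearMap.adjoint_inner_right,
      ← inner_ket c, RCLike.inner_apply', inner_conj_symm]
  have h2 : ∀ d, inner ℂ (R (ket d)) (A (R (ket d))) = ∑' c, (A * R) (ket d) c * R (ket c) d := by
    intro d
    rw [← (lp.hasSum_inner _ _).tsum_eq]
    refine tsum_congr fun c => ?_
    rw [← hRadj c d, RCLike.inner_apply', mul_comm, ← inner_ket c (R (ket d)), inner_conj_symm]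
    rfl
  have h3 : trace (A * σ) = ∑' d, inner ℂ (R (ket d)) (A (R (ket d))) := by
    rw [trace, tsum_congr h1, tsum_congr h2, hs.tsum_comm]
  have h4 : Summable fun d => inner ℂ (R (ket d)) (A (R (ket d))) :=
    (hs.prod_symm.prod).congr fun d => (h2 d).symm
  rw [h3, Complex.re_tsum h4, pairing, ENNReal.tsum_toReal_eq]
  · refine tsum_congr fun d => ?_
    rw [quad, ENNReal.toReal_ofReal (re_inner_nonneg hA _)]
  · exact fun d => ENNReal.ofReal_ne_top

theorem trace_re {σ : Op C} (hσ : PosTraceClass σ) : (trace σ).re = (pairing 1 σ).toReal := by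
  rw [← trace_mul_re zero_le_one hσ, one_mul]

/-! ### Kraus families and their duals -/

/-- A family of operators with `∑ Kᵢ† Kᵢ = I`. -/
def IsKraus {ι : Type*} (K : ι → Op C) : Prop := ∀ ψ, ∑' i, ‖K i ψ‖ₑ ^ 2 = ‖ψ‖ₑ ^ 2

theorem IsKraus.hasOpSum {ι : Type*} {K : ι → Op C} (hK : IsKraus K) :
    HasOpSum (fun i => adj (K i) * K i) 1 := by
  refine fun φ => hasSum_of_quad_eq (fun i => adjoint_mul_self_nonneg _) zero_le_one (fun ψ => ?_) φ
  rw [quad_one, ← hK]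
  refine tsum_congr fun i => ?_
  have := quad_conj (K i) 1 ψ
  rw [mul_one, quad_one] at this
  exact this.symm

theorem IsKraus.pairing_one {ι : Type*} {K : ι → Op C} (hK : IsKraus K) {ρ : Op C} (hρ : 0 ≤ ρ) :
    ∑' i, pairing 1 (K i * ρ * adj (K i)) = pairing 1 ρ := by
  rw [pairing_hasOpSum_left (fun i => adjoint_mul_self_nonneg _) hK.hasOpSum]
  refine tsum_congr fun i => ?_
  rw [← pairing_conj zero_le_one hρ, mul_one]

theorem IsKraus.posTraceClass {ι : Type*} {K : ι → Op C} (hK : IsKraus K) {ρ : Op C}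
    (hρ : PosTraceClass ρ) (i : ι) : PosTraceClass (K i * ρ * adj (K i)) :=
  ⟨conj_nonneg' hρ.1 _, ne_top_of_le_ne_top hρ.2 <| by
    rw [← hK.pairing_one hρ.1]
    exact ENNReal.le_tsum i⟩

/-- Backward action of a Kraus family on a family of predicates. -/
theorem IsKraus.exists_dual {ι : Type*} {K B : ι → Op C} (hK : IsKraus K)
    (hB : ∀ i, 0 ≤ B i ∧ B i ≤ 1) : ∃ W : Op C, (0 ≤ W ∧ W ≤ 1) ∧
      HasOpSum (fun i => adj (K i) * (1 - B i) * K i) (1 - W) ∧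
      ∀ ρ, 0 ≤ ρ → pairing W ρ = ∑' i, pairing (B i) (K i * ρ * adj (K i)) := by
  have hpos : ∀ i, 0 ≤ adj (K i) * B i * K i := fun i => conj_nonneg (hB i).1 _
  have hle : ∀ φ, ∑' i, quad (adj (K i) * B i * K i) φ ≤ quad 1 φ := fun φ => by
    rw [quad_one, ← hK]
    refine ENNReal.tsum_le_tsum fun i => ?_
    rw [quad_conj, ← quad_one]
    exact quad_mono (hB i).2 _
  obtain ⟨W, hW, hs⟩ := exists_hasSum_of_quad_le hpos zero_le_one fun φ => by
    rw [one_mul, ofReal_norm_sq, ← quad_one]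
    exact hle φ
  refine ⟨W, ⟨hW, le_of_quad_le hW zero_le_one fun φ => ?_⟩, fun φ => ?_, fun ρ hρ => ?_⟩
  · rw [quad_hasSum hpos (hs φ)]
    exact hle φ
  -- Subtracting ∑ K†BK = W from ∑ K†K = I: complementation commutes with the backward action.
  · have := (hK.hasOpSum φ).sub (hs φ)
    simpa only [mul_sub, sub_mul, mul_one, sub_apply] using this
  · rw [pairing_hasOpSum_left hpos hs]
    exact tsum_congr fun i => pairing_conj (hB i).1 hρ _

end Trace

/-! ### Cylinder extensions -/

section Cylinder

variable {C X Y : Type*} (e : C ≃ X × Y)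

theorem slice_apply (y : Y) (ψ : L2 C) (x : X) : slice e y ψ x = ψ (e.symm (x, y)) := rfl

theorem tensorId_apply (A : Op X) (ψ : L2 C) (c : C) :
    tensorId e A ψ c = A (slice e (e c).2 ψ) (e c).1 := rfl

theorem slice_tensorId (A : Op X) (ψ : L2 C) (y : Y) :
    slice e y (tensorId e A ψ) = A (slice e y ψ) := by
  ext x
  rw [slice_apply, tensorId_apply, Equiv.apply_symm_apply]

theorem hasSum_inner_slice (ψ φ : L2 C) :
    HasSum (fun y => inner ℂ (slice e y ψ) (slice e y φ)) (inner ℂ ψ φ) := by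
  have h : HasSum (fun p : Y × X => inner ℂ (ψ (e.symm (p.2, p.1))) (φ (e.symm (p.2, p.1))))
      (inner ℂ ψ φ) :=
    ((Equiv.prodComm Y X).trans e.symm).hasSum_iff (f := fun c => inner ℂ (ψ c) (φ c)) |>.2
      (lp.hasSum_inner ψ φ)
  exact h.prod_fiberwise fun y => lp.hasSum_inner (slice e y ψ) (slice e y φ)

theorem tensorId_adj (A : Op X) : tensorId e (adj A) = adj (tensorId e A) := by
  rw [ContinuousLinearMap.eq_adjoint_iff]
  intro ψ φ
  refine (hasSum_inner_slice e _ _).unique ?_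
  simpa only [slice_tensorId, ContinuousLinearMap.adjoint_inner_left] using
    hasSum_inner_slice e ψ (tensorId e A φ)

theorem enorm_sq_slice (ψ : L2 C) : ‖ψ‖ₑ ^ 2 = ∑' y, ‖slice e y ψ‖ₑ ^ 2 := by
  rw [← ofReal_norm_sq, ← (hasSum_slice e ψ).tsum_eq,
    ENNReal.ofReal_tsum_of_nonneg (fun _ => sq_nonneg _) (hasSum_slice e ψ).summable]
  simp only [ofReal_norm_sq]

/-- A ⊗ I acts slice by slice and squared norms add over slices, so the claim is an exchange of two
nonnegative sums. -/
theorem IsKraus.tensorId {ι : Type*} {K : ι → Op X} (hK : IsKraus K) :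
    IsKraus fun i => tensorId e (K i) := by
  intro ψ
  simp only [enorm_sq_slice e, slice_tensorId]
  rw [ENNReal.tsum_comm]
  exact tsum_congr fun y => hK _

theorem adj_ketBra (c d : C) : adj (ketBra c d) = ketBra d c := by
  symm
  rw [ContinuousLinearMap.eq_adjoint_iff]
  intro x y
  simp only [ketBra, ContinuousLinearMap.smulRight_apply, innerSL_apply_apply, inner_smul_left,
    inner_smul_right, inner_conj_symm]
  ring

theorem isKraus_ketBra (c : C) : IsKraus fun d => ketBra c d := by
  intro ψ
  rw [enorm_sq_eq_tsum]
  refine tsum_congr fun d => ?_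
  have h : ‖(ket c : L2 C)‖ₑ = 1 := by rw [← ofReal_norm, norm_ket, ENNReal.ofReal_one]
  change ‖(innerSL ℂ (ket d)).smulRight (ket c) ψ‖ₑ ^ 2 = _
  rw [ContinuousLinearMap.smulRight_apply, innerSL_apply_apply, inner_ket, enorm_smul, h,
    mul_one]

theorem isKraus_of_hasOpSum {ι : Type*} {K : ι → Op C}
    (h : HasOpSum (fun i => adj (K i) * K i) 1) : IsKraus K := by
  intro ψ
  rw [← quad_one, quad_hasSum (fun i => adjoint_mul_self_nonneg _) (h ψ)]
  refine tsum_congr fun i => ?_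
  have := quad_conj (K i) 1 ψ
  rw [mul_one, quad_one] at this
  exact this.symm

end Cylinder

/-! ### Kraus families of the program statements -/

section Variables

variable {Var : Type u} {ty : Var → QType}

theorem IsMeasurement.isKraus {X : Finset Var} {ι : Type} {M : ι → RegOp ty X}
    (hM : IsMeasurement M) : IsKraus fun m => cyl (M m) :=
  (isKraus_of_hasOpSum hM).tensorId _

theorem isKraus_unitary {X : Finset Var} {U : RegOp ty X} (hU : adj U * U = 1) :
    IsKraus fun _ : Unit => cyl U := by
  refine IsKraus.tensorId _ (isKraus_of_hasOpSum fun ψ => ?_)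
  rw [hU]
  exact hasSum_unique _

theorem isKraus_reset (q : Var) :
    IsKraus fun n : RegBasis ty {q} => varKetBra 0 n :=
  (isKraus_ketBra 0).tensorId _

theorem adj_varKetBra {q : Var} (x y : RegBasis ty {q}) :
    adj (varKetBra x y) = varKetBra y x := by
  rw [varKetBra, varKetBra, cyl, cyl, ← tensorId_adj, adj_ketBra]

end Variables

/-! ### Sums over computations -/

theorem tsum_iSup_of_monotone {α : Type*} {f : α → ℕ → ℝ≥0∞} (hf : ∀ a, Monotone (f a)) :
    ∑' a, ⨆ n, f a n = ⨆ n, ∑' a, f a n := by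
  simp only [ENNReal.tsum_eq_iSup_sum]
  rw [iSup_comm]
  exact iSup_congr fun s => ENNReal.finsetSum_iSup_of_monotone hf

section Runs

variable {Var : Type u} {ty : Var → QType}

/-- The transitions from a configuration. -/
abbrev Steps (c : Conf ty) := Σ c' : Conf ty, Step c c'

/-- The terminating computations from a configuration. -/
abbrev Runs (c : Conf ty) := Σ ρ' : GlobalOp ty, Run c (none, ρ')

/-- The sum of `G` over the results of all terminating computations from `c`. -/
noncomputable def runSum (G : GlobalOp ty → ℝ≥0∞) (c : Conf ty) : ℝ≥0∞ := ∑' r : Runs c, G r.1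

/-- The sum of `G` over the results of all terminating computations of length at most `n`. -/
noncomputable def boundedSum (G : GlobalOp ty → ℝ≥0∞) : ℕ → Conf ty → ℝ≥0∞
  | _, (none, ρ) => G ρ
  | 0, (some _, _) => 0
  | n + 1, (some S, ρ) => ∑' s : Steps (some S, ρ), boundedSum G n s.1

/-- The number of transitions in a computation. -/
def Run.length : {a b : Conf ty} → Run a b → ℕ
  | _, _, .refl _ => 0
  | _, _, .head _ r => r.length + 1

/-- A terminating computation of a nonempty program consists of a transition and a computation. -/
def runsEquiv (S : Prog ty) (ρ : GlobalOp ty) :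
    Runs (some S, ρ) ≃ Σ s : Steps (some S, ρ), Runs s.1 where
  toFun r := match r with
    | ⟨ρ', .head s r⟩ => ⟨⟨_, s⟩, ⟨ρ', r⟩⟩
  invFun p := ⟨p.2.1, .head p.1.2 p.2.2⟩
  left_inv r := match r with
    | ⟨_, .head _ _⟩ => rfl
  right_inv _ := rfl

/-- The only computation of the empty program is the empty one. -/
def runsNoneEquiv (ρ : GlobalOp ty) : Unit ≃ Runs ((none, ρ) : Conf ty) where
  toFun _ := ⟨ρ, .refl _⟩
  invFun _ := ()
  left_inv _ := rfl
  right_inv r := match r with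
    | ⟨_, .refl _⟩ => rfl
    | ⟨_, .head s _⟩ => nomatch s

theorem runSum_none (G : GlobalOp ty → ℝ≥0∞) (ρ : GlobalOp ty) : runSum G (none, ρ) = G ρ := by
  rw [runSum, ← (runsNoneEquiv ρ).tsum_eq]
  simp [runsNoneEquiv]

theorem runSum_some (G : GlobalOp ty → ℝ≥0∞) (S : Prog ty) (ρ : GlobalOp ty) :
    runSum G (some S, ρ) = ∑' s : Steps (some S, ρ), runSum G s.1 := by
  rw [runSum, ← (runsEquiv S ρ).symm.tsum_eq, ENNReal.tsum_sigma']
  rfl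

/-- The recursive form supports induction on n; the filtered sum makes monotonicity in n and the
limit visible. -/
theorem tsum_length_le (G : GlobalOp ty → ℝ≥0∞) (n : ℕ) (c : Conf ty) :
    ∑' r : Runs c, (if r.2.length ≤ n then G r.1 else 0) = boundedSum G n c := by
  induction n generalizing c with
  | zero =>
    obtain ⟨_ | S, ρ⟩ := c
    · rw [← (runsNoneEquiv ρ).tsum_eq]
      simp [runsNoneEquiv, boundedSum, Run.length]
    · rw [← (runsEquiv S ρ).symm.tsum_eq]
      simp [runsEquiv, boundedSum, Run.length]
  | succ n ih =>
    obtain ⟨_ | S, ρ⟩ := c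
    · rw [← (runsNoneEquiv ρ).tsum_eq]
      simp [runsNoneEquiv, boundedSum, Run.length]
    · rw [← (runsEquiv S ρ).symm.tsum_eq, ENNReal.tsum_sigma', boundedSum]
      refine tsum_congr fun s => ?_
      rw [← ih]
      simp [runsEquiv, Run.length]

theorem runSum_eq_iSup (G : GlobalOp ty → ℝ≥0∞) (c : Conf ty) :
    runSum G c = ⨆ n, boundedSum G n c := by
  simp only [← tsum_length_le]
  rw [← tsum_iSup_of_monotone]
  · refine tsum_congr fun r => le_antisymm ?_ (iSup_le fun n => ?_)
    · refine le_iSup_of_le r.2.length ?_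
      simp
    · split_ifs <;> simp
  · intro r m n hmn
    dsimp only
    split_ifs with h1 h2
    · exact le_rfl
    · exact absurd (h1.trans hmn) h2
    · exact zero_le
    · exact le_rfl

theorem boundedSum_le_runSum (G : GlobalOp ty → ℝ≥0∞) (n : ℕ) (c : Conf ty) :
    boundedSum G n c ≤ runSum G c := by
  rw [runSum_eq_iSup]
  exact le_iSup (fun n => boundedSum G n c) n

theorem boundedSum_succ_ge (G : GlobalOp ty → ℝ≥0∞) (n : ℕ) (c : Conf ty) :
    boundedSum G n c ≤ boundedSum G (n + 1) c := by
  rw [← tsum_length_le, ← tsum_length_le]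
  refine ENNReal.tsum_le_tsum fun r => ?_
  split_ifs with h1 h2
  · exact le_rfl
  · omega
  · exact zero_le
  · exact le_rfl

/-- Sequential composition of a configuration with a program. -/
def Conf.seq (S₂ : Prog ty) : Conf ty → Conf ty
  | (none, ρ) => (some S₂, ρ)
  | (some S, ρ) => (some (.seq S S₂), ρ)

/-- The transitions of `S₁; S₂` are those of `S₁`. -/
noncomputable def stepsSeqEquiv (S₁ S₂ : Prog ty) (ρ : GlobalOp ty) :
    Steps (some S₁, ρ) ≃ Steps (some (.seq S₁ S₂), ρ) where
  toFun s := match s with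
    | ⟨(none, _), s⟩ => ⟨_, .seqEnd S₂ s⟩
    | ⟨(some _, _), s⟩ => ⟨_, .seq S₂ s⟩
  invFun s := match s with
    | ⟨_, .seqEnd _ s⟩ => ⟨_, s⟩
    | ⟨_, .seq _ s⟩ => ⟨_, s⟩
  left_inv s := match s with
    | ⟨(none, _), _⟩ => rfl
    | ⟨(some _, _), _⟩ => rfl
  right_inv s := match s with
    | ⟨_, .seqEnd _ _⟩ => rfl
    | ⟨_, .seq _ _⟩ => rfl

theorem tsum_steps_seq (H : Conf ty → ℝ≥0∞) (S₁ S₂ : Prog ty) (ρ : GlobalOp ty) :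
    ∑' s : Steps (some (.seq S₁ S₂), ρ), H s.1 = ∑' s : Steps (some S₁, ρ), H (s.1.seq S₂) := by
  rw [← (stepsSeqEquiv S₁ S₂ ρ).tsum_eq]
  refine tsum_congr fun s => ?_
  obtain ⟨⟨_ | S, ρ'⟩, s⟩ := s <;> rfl

/-- The transition of `skip`. -/
noncomputable def stepsSkipEquiv (ρ : GlobalOp ty) : Unit ≃ Steps ((some .skip, ρ) : Conf ty) where
  toFun _ := ⟨_, .skip ρ⟩
  invFun _ := ()
  left_inv _ := rfl
  right_inv s := match s with
    | ⟨_, .skip _⟩ => rfl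

theorem tsum_steps_skip (H : Conf ty → ℝ≥0∞) (ρ : GlobalOp ty) :
    ∑' s : Steps (some .skip, ρ), H s.1 = H (none, ρ) := by
  rw [← (stepsSkipEquiv ρ).tsum_eq]
  simp [stepsSkipEquiv]

/-- The transition of `q := 0`. -/
noncomputable def stepsResetEquiv (q : Var) (ρ : GlobalOp ty) : Unit ≃ Steps (some (.reset q), ρ) where
  toFun _ := ⟨_, .reset q ρ⟩
  invFun _ := ()
  left_inv _ := rfl
  right_inv s := match s with
    | ⟨_, .reset _ _⟩ => rfl

theorem tsum_steps_reset (H : Conf ty → ℝ≥0∞) (q : Var) (ρ : GlobalOp ty) :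
    ∑' s : Steps (some (.reset q), ρ), H s.1 = H (none, resetState q ρ) := by
  rw [← (stepsResetEquiv q ρ).tsum_eq]
  simp [stepsResetEquiv]

/-- The transition of a unitary statement. -/
noncomputable def stepsUnitaryEquiv (X : Finset Var) (U : RegOp ty X) (hU : adj U * U = 1) (ρ : GlobalOp ty) :
    Unit ≃ Steps (some (.unitary X U hU), ρ) where
  toFun _ := ⟨_, .unitary X U hU ρ⟩
  invFun _ := ()
  left_inv _ := rfl
  right_inv s := match s with
    | ⟨_, .unitary _ _ _ _⟩ => rfl

theorem tsum_steps_unitary (H : Conf ty → ℝ≥0∞) (X : Finset Var) (U : RegOp ty X)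
    (hU : adj U * U = 1) (ρ : GlobalOp ty) :
    ∑' s : Steps (some (.unitary X U hU), ρ), H s.1 = H (none, cyl U * ρ * adj (cyl U)) := by
  rw [← (stepsUnitaryEquiv X U hU ρ).tsum_eq]
  simp [stepsUnitaryEquiv]

/-- The transitions of a measurement statement. -/
noncomputable def stepsMeasureEquiv (X : Finset Var) (ι : Type) (M : ι → RegOp ty X) (hM : IsMeasurement M)
    (S : ι → Prog ty) (ρ : GlobalOp ty) : ι ≃ Steps (some (.measure X ι M hM S), ρ) where
  toFun m := ⟨_, .measure X ι M hM S m ρ⟩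
  invFun s := match s with
    | ⟨_, .measure _ _ _ _ _ m _⟩ => m
  left_inv _ := rfl
  right_inv s := match s with
    | ⟨_, .measure _ _ _ _ _ _ _⟩ => rfl

theorem tsum_steps_measure (H : Conf ty → ℝ≥0∞) (X : Finset Var) (ι : Type) (M : ι → RegOp ty X)
    (hM : IsMeasurement M) (S : ι → Prog ty) (ρ : GlobalOp ty) :
    ∑' s : Steps (some (.measure X ι M hM S), ρ), H s.1 =
      ∑' m, H (some (S m), cyl (M m) * ρ * adj (cyl (M m))) := by
  rw [← (stepsMeasureEquiv X ι M hM S ρ).tsum_eq]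
  rfl

/-- The transitions of a loop. -/
noncomputable def stepsLoopEquiv (X : Finset Var) (M : Fin 2 → RegOp ty X) (hM : IsMeasurement M)
    (S : Prog ty) (ρ : GlobalOp ty) : Bool ≃ Steps (some (.loop X M hM S), ρ) where
  toFun b := match b with
    | false => ⟨_, .loop0 X M hM S ρ⟩
    | true => ⟨_, .loop1 X M hM S ρ⟩
  invFun s := match s with
    | ⟨_, .loop0 _ _ _ _ _⟩ => false
    | ⟨_, .loop1 _ _ _ _ _⟩ => true
  left_inv b := match b with
    | false => rfl
    | true => rfl
  right_inv s := match s with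
    | ⟨_, .loop0 _ _ _ _ _⟩ => rfl
    | ⟨_, .loop1 _ _ _ _ _⟩ => rfl

theorem tsum_steps_loop (H : Conf ty → ℝ≥0∞) (X : Finset Var) (M : Fin 2 → RegOp ty X)
    (hM : IsMeasurement M) (S : Prog ty) (ρ : GlobalOp ty) :
    ∑' s : Steps (some (.loop X M hM S), ρ), H s.1 =
      H (none, cyl (M 0) * ρ * adj (cyl (M 0))) +
        H (some (.seq S (.loop X M hM S)), cyl (M 1) * ρ * adj (cyl (M 1))) := by
  rw [← (stepsLoopEquiv X M hM S ρ).tsum_eq, tsum_bool]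
  rfl

/-! ### Computations of sequential compositions -/

/-- In a computation of length at most n, the part spent in `S₂` has length at most n as well; the
first part may be left unbounded. -/
theorem boundedSum_seq_le (G : GlobalOp ty → ℝ≥0∞) (S₂ : Prog ty) (n : ℕ) (c : Conf ty) :
    boundedSum G n (c.seq S₂) ≤ runSum (fun ρ => boundedSum G n (some S₂, ρ)) c := by
  induction n generalizing c with
  | zero =>
    obtain ⟨_ | S, ρ⟩ := c
    · rw [runSum_none]; rfl
    · exact zero_le
  | succ n ih =>
    obtain ⟨_ | S, ρ⟩ := c
    · rw [runSum_none]; rfl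
    · rw [runSum_some, Conf.seq, boundedSum, tsum_steps_seq (boundedSum G n)]
      refine ENNReal.tsum_le_tsum fun s => (ih s.1).trans ?_
      exact ENNReal.tsum_le_tsum fun r => boundedSum_succ_ge G n _

/-- Computations of a composition split at the moment the first program ends. Each inequality is an
induction on a length bound: on the whole computation for ≤, on the first part for ≥. -/
theorem runSum_seq (G : GlobalOp ty → ℝ≥0∞) (S₂ : Prog ty) (c : Conf ty) :
    runSum G (c.seq S₂) = runSum (fun ρ => runSum G (some S₂, ρ)) c := by
  apply le_antisymm
  · rw [runSum_eq_iSup]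
    exact iSup_le fun n => (boundedSum_seq_le G S₂ n c).trans <|
      ENNReal.tsum_le_tsum fun r => boundedSum_le_runSum G n _
  · rw [runSum_eq_iSup (fun ρ => runSum G (some S₂, ρ))]
    refine iSup_le fun n => ?_
    induction n generalizing c with
    | zero =>
      obtain ⟨_ | S, ρ⟩ := c
      · exact le_rfl
      · exact zero_le
    | succ n ih =>
      obtain ⟨_ | S, ρ⟩ := c
      · exact le_rfl
      · rw [boundedSum, Conf.seq, runSum_some, tsum_steps_seq (runSum G)]
        exact ENNReal.tsum_le_tsum fun s => ih s.1

end Runs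

/-! ### Computations preserve positive trace-class operators -/

section TraceClass

variable {Var : Type u} {ty : Var → QType}

theorem resetState_eq (q : Var) (ρ : GlobalOp ty) : resetState q ρ =
    opSum fun n : RegBasis ty {q} => varKetBra 0 n * ρ * adj (varKetBra 0 n) := by
  simp only [resetState, adj_varKetBra]

theorem tsum_reset_ne_top (q : Var) {ρ : GlobalOp ty} (hρ : PosTraceClass ρ) :
    ∑' n : RegBasis ty {q}, pairing 1 (varKetBra 0 n * ρ * adj (varKetBra 0 n)) ≠ ⊤ := by
  rw [(isKraus_reset q).pairing_one hρ.1]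
  exact hρ.2

theorem pairing_resetState (q : Var) {ρ A : GlobalOp ty} (hρ : PosTraceClass ρ) (hA : 0 ≤ A) :
    pairing A (resetState q ρ) =
      ∑' n : RegBasis ty {q}, pairing A (varKetBra 0 n * ρ * adj (varKetBra 0 n)) := by
  rw [resetState_eq]
  exact pairing_opSum (fun n => conj_nonneg' hρ.1 _) (tsum_reset_ne_top q hρ) hA

/-- Every statement acts through a Kraus family, which preserves total trace; a composition inherits
the steps of its first program. -/
theorem tsum_steps_pairing_one_le (S : Prog ty) {ρ : GlobalOp ty} (hρ : PosTraceClass ρ) :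
    ∑' s : Steps (some S, ρ), pairing 1 s.1.2 ≤ pairing 1 ρ := by
  induction S with
  | skip => exact (tsum_steps_skip (fun c => pairing 1 c.2) ρ).le
  | reset q =>
    rw [tsum_steps_reset (fun c => pairing 1 c.2), pairing_resetState q hρ zero_le_one,
      (isKraus_reset q).pairing_one hρ.1]
  | unitary X U hU =>
    rw [tsum_steps_unitary (fun c => pairing 1 c.2), ← (isKraus_unitary hU).pairing_one hρ.1]
    simp
  | seq S₁ S₂ ih _ =>
    rw [tsum_steps_seq (fun c => pairing 1 c.2)]
    refine le_trans (le_of_eq (tsum_congr fun s => ?_)) ih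
    obtain ⟨⟨_ | S, ρ'⟩, s⟩ := s <;> rfl
  | measure X ι M hM S _ =>
    rw [tsum_steps_measure (fun c => pairing 1 c.2), ← hM.isKraus.pairing_one hρ.1]
  | loop X M hM S _ =>
    rw [tsum_steps_loop (fun c => pairing 1 c.2), ← hM.isKraus.pairing_one hρ.1, tsum_fintype,
      Fin.sum_univ_two]

theorem Step.nonneg {c c' : Conf ty} (s : Step c c') (h : PosTraceClass c.2) : 0 ≤ c'.2 := by
  induction s with
  | skip => exact h.1
  | reset q ρ =>
    rw [resetState_eq]
    exact (hasOpSum_of_pairing_ne_top (fun n => conj_nonneg' h.1 _) (tsum_reset_ne_top q h)).1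
  | unitary => exact conj_nonneg' h.1 _
  | seq _ _ ih => exact ih h
  | seqEnd _ _ ih => exact ih h
  | measure => exact conj_nonneg' h.1 _
  | loop0 => exact conj_nonneg' h.1 _
  | loop1 => exact conj_nonneg' h.1 _

theorem Step.posTraceClass {c c' : Conf ty} (s : Step c c') (h : PosTraceClass c.2) :
    PosTraceClass c'.2 := by
  refine ⟨s.nonneg h, ?_⟩
  obtain ⟨_ | S, ρ⟩ := c
  · exact nomatch s
  · refine ne_top_of_le_ne_top h.2 (le_trans ?_ (tsum_steps_pairing_one_le S h))
    exact ENNReal.le_tsum (f := fun s : Steps (some S, ρ) => pairing 1 s.1.2) ⟨c', s⟩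

theorem Run.posTraceClass {c c' : Conf ty} (r : Run c c') (h : PosTraceClass c.2) :
    PosTraceClass c'.2 := by
  induction r with
  | refl => exact h
  | head s _ ih => exact ih (s.posTraceClass h)

theorem runSum_congr {G G' : GlobalOp ty → ℝ≥0∞} (hG : ∀ ρ, PosTraceClass ρ → G ρ = G' ρ)
    {c : Conf ty} (hc : PosTraceClass c.2) : runSum G c = runSum G' c :=
  tsum_congr fun r => hG _ (r.2.posTraceClass hc)

theorem runSum_mono {G G' : GlobalOp ty → ℝ≥0∞} (hG : ∀ ρ, PosTraceClass ρ → G ρ ≤ G' ρ)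
    {c : Conf ty} (hc : PosTraceClass c.2) : runSum G c ≤ runSum G' c :=
  ENNReal.tsum_le_tsum fun r => hG _ (r.2.posTraceClass hc)

theorem runSum_pairing_one_le {c : Conf ty} (hc : PosTraceClass c.2) :
    runSum (pairing 1) c ≤ pairing 1 c.2 := by
  rw [runSum_eq_iSup]
  refine iSup_le fun n => ?_
  induction n generalizing c with
  | zero =>
    obtain ⟨_ | S, ρ⟩ := c
    · exact le_rfl
    · exact zero_le
  | succ n ih =>
    obtain ⟨_ | S, ρ⟩ := c
    · exact le_rfl
    · exact (ENNReal.tsum_le_tsum fun s => ih (s.2.posTraceClass hc)).trans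
        (tsum_steps_pairing_one_le S hc)

/-- The results of all terminating computations have total trace at most that of ρ, so the defining
`opSum` really converges and is not its default value 0. -/
theorem denote_posTraceClass (S : Prog ty) {ρ : GlobalOp ty} (hρ : PosTraceClass ρ) :
    PosTraceClass (denote S ρ) ∧
      ∀ A, 0 ≤ A → pairing A (denote S ρ) = runSum (pairing A) (some S, ρ) := by
  have h1 : ∀ r : Runs (some S, ρ), 0 ≤ r.1 := fun r => (r.2.posTraceClass hρ).1
  have h2 : ∑' r : Runs (some S, ρ), pairing 1 r.1 ≠ ⊤ :=
    ne_top_of_le_ne_top hρ.2 (runSum_pairing_one_le (c := (some S, ρ)) hρ)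
  have h3 := fun (A : GlobalOp ty) (hA : 0 ≤ A) => pairing_opSum h1 h2 hA
  refine ⟨⟨(hasOpSum_of_pairing_ne_top h1 h2).1, ?_⟩, h3⟩
  exact ((h3 1 zero_le_one).trans_ne h2)

end TraceClass

/-! ### Weakest liberal preconditions -/

/-- The limit is the sum of the positive differences W (n + 1) - W n, whose partial sums telescope
because W 0 = 0. -/
theorem exists_pairing_eq_iSup {C : Type*} {W : ℕ → Op C} (h0 : W 0 = 0)
    (hW : ∀ n, W n ≤ W (n + 1)) (h1 : ∀ n, W n ≤ 1) :
    ∃ V : Op C, (0 ≤ V ∧ V ≤ 1) ∧ ∀ ρ, pairing V ρ = ⨆ n, pairing (W n) ρ := by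
  have hpos : ∀ n, 0 ≤ W n := fun n => h0 ▸ monotone_nat_of_le_succ hW (Nat.zero_le n)
  have hD : ∀ n, 0 ≤ W (n + 1) - W n := fun n => sub_nonneg.2 (hW n)
  have hsum : ∀ ρ, ∑' n, pairing (W (n + 1) - W n) ρ = ⨆ n, pairing (W n) ρ := fun ρ => by
    rw [ENNReal.tsum_eq_iSup_nat]
    refine iSup_congr fun n => ?_
    induction n with
    | zero => rw [h0, pairing_zero, Finset.sum_range_zero]
    | succ n ih =>
      rw [Finset.sum_range_succ, ih, ← pairing_add (hpos n) (hD n), add_sub_cancel]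
  obtain ⟨V, hV, hs⟩ := exists_hasSum_of_quad_le hD zero_le_one fun φ => by
    simp only [← pairing_proj (hD _)]
    rw [hsum, one_mul, ofReal_norm_sq, ← pairing_one_proj]
    exact iSup_le fun n => pairing_mono (h1 n) _
  have hV' : ∀ ρ, pairing V ρ = ⨆ n, pairing (W n) ρ := fun ρ => by
    rw [pairing_hasOpSum_left hD hs, hsum]
  refine ⟨V, ⟨hV, le_of_pairing_le hV zero_le_one fun φ => ?_⟩, hV'⟩
  rw [hV']
  exact iSup_le fun n => pairing_mono (h1 n) _

theorem posTraceClass_proj {C : Type*} (φ : L2 C) : PosTraceClass (proj φ) :=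
  ⟨proj_nonneg φ, by rw [pairing_one_proj]; simp⟩

section Completeness

variable {Var : Type u} {ty : Var → QType}

/-- The complement of a quantum predicate. -/
noncomputable def QPred.compl (P : QPred ty) : QPred ty :=
  ⟨1 - P.1, sub_nonneg.2 P.2.2, sub_le_self _ P.2.1⟩

theorem QPred.compl_compl (P : QPred ty) : P.compl.compl = P :=
  Subtype.ext (sub_sub_cancel _ _)

theorem IsKraus.exists_dual_pred {ι : Type*} {K : ι → GlobalOp ty} (hK : IsKraus K)
    (B : ι → QPred ty) : ∃ W : QPred ty,
      HasOpSum (fun i => adj (K i) * (B i).compl.1 * K i) W.compl.1 ∧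
      ∀ ρ, 0 ≤ ρ → pairing W.1 ρ = ∑' i, pairing (B i).1 (K i * ρ * adj (K i)) := by
  obtain ⟨W, hW, h1, h2⟩ := hK.exists_dual fun i => (B i).2
  exact ⟨⟨W, hW⟩, h1, h2⟩

/-- `W.compl` is a provable precondition of `B.compl`, and `W` has the expectation that `B` has
after execution of `S`. -/
def IsDual (S : Prog ty) (B W : QPred ty) : Prop :=
  Provable W.compl S B.compl ∧
    ∀ ρ, PosTraceClass ρ → pairing W.1 ρ = runSum (pairing B.1) (some S, ρ)

/-- Kleene iteration. The dual `g` of the body is obtained by choice; its monotonicity and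
continuity come from expressing its expectations as sums over computations. -/
theorem exists_isDual_loop {X : Finset Var} {M : Fin 2 → RegOp ty X} (hM : IsMeasurement M)
    {S : Prog ty} (ih : ∀ B, ∃ W, IsDual S B W) (B : QPred ty) :
    ∃ W, IsDual (.loop X M hM S) B W := by
  choose g hg using ih
  choose Φ hΦ₁ hΦ₂ using fun V : QPred ty => hM.isKraus.exists_dual_pred ![B, g V]
  have hΦ : ∀ (V : QPred ty) {ρ}, PosTraceClass ρ → pairing (Φ V).1 ρ =
      pairing B.1 (cyl (M 0) * ρ * adj (cyl (M 0))) +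
        pairing (g V).1 (cyl (M 1) * ρ * adj (cyl (M 1))) := fun V ρ hρ => by
    rw [hΦ₂ V ρ hρ.1, tsum_fintype, Fin.sum_univ_two]
    rfl
  have hM1 : ∀ {ρ}, PosTraceClass ρ → PosTraceClass (cyl (M 1) * ρ * adj (cyl (M 1))) :=
    fun hρ => hM.isKraus.posTraceClass hρ 1
  let W : ℕ → QPred ty := fun n => Φ^[n] ⟨0, le_rfl, zero_le_one⟩
  have hWs : ∀ n, W (n + 1) = Φ (W n) := fun n => Function.iterate_succ_apply' _ _ _
  have hmono : ∀ n, (W n).1 ≤ (W (n + 1)).1 := fun n => by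
    induction n with
    | zero => exact (W 1).2.1
    | succ n ih =>
      refine le_of_pairing_le (W _).2.1 (W _).2.1 fun φ => ?_
      have hφ := posTraceClass_proj φ
      rw [hWs (n + 1), hΦ _ hφ, hWs n, hΦ _ hφ, (hg _).2 _ (hM1 hφ), (hg _).2 _ (hM1 hφ), ← hWs n]
      gcongr
      exact runSum_mono (fun ρ _ => pairing_mono ih ρ) (hM1 hφ)
  obtain ⟨V, hV, hVs⟩ := exists_pairing_eq_iSup (W := fun n => (W n).1) rfl hmono
    fun n => (W n).2.2
  let V' : QPred ty := ⟨V, hV⟩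
  have hgV : ∀ {ρ}, PosTraceClass ρ → pairing (g V').1 ρ = ⨆ n, pairing (g (W n)).1 ρ :=
    fun {ρ} hρ => by
      rw [(hg V').2 _ hρ]
      simp only [(hg _).2 _ hρ, runSum]
      -- Continuity of `g` along the iterates: monotone convergence over the computations of the
      -- body.
      exact (tsum_congr fun r => hVs _).trans <| tsum_iSup_of_monotone fun r =>
        monotone_nat_of_le_succ fun n => pairing_mono (hmono n) _
  have hfix : Φ V' = V' := Subtype.ext <| eq_of_pairing_eq (Φ V').2.1 hV.1 fun φ => by
    have hφ := posTraceClass_proj φ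
    have hm : Monotone fun n => pairing (W n).1 (proj φ) :=
      monotone_nat_of_le_succ fun n => pairing_mono (hmono n) _
    -- Dropping the 0th iterate does not change the supremum, and the shifted iterates are the
    -- values of `Φ`.
    rw [hΦ _ hφ, hgV (hM1 hφ), hVs, ENNReal.add_iSup, ← hm.iSup_nat_add 1]
    exact iSup_congr fun n => by rw [hWs, hΦ _ hφ]
  have hloop : ∀ ρ, runSum (pairing B.1) (some (.loop X M hM S), ρ) =
      pairing B.1 (cyl (M 0) * ρ * adj (cyl (M 0))) +
        runSum (fun ρ => runSum (pairing B.1) (some (.loop X M hM S), ρ))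
          (some S, cyl (M 1) * ρ * adj (cyl (M 1))) := fun ρ => by
    rw [runSum_some, tsum_steps_loop (runSum (pairing B.1)), runSum_none, ← runSum_seq]
    rfl
  refine ⟨V', .loop X M hM S B.compl (g V').compl V'.compl ?_ (hg V').1, fun ρ hρ => ?_⟩
  · have h1 := hΦ₁ V'
    rw [hfix] at h1
    refine hasOpSum_unique h1 fun ψ => ?_
    have h2 := hasSum_fintype fun i : Fin 2 =>
      (adj (cyl (M i)) * (![B, g V'] i).compl.1 * cyl (M i)) ψ
    rw [Fin.sum_univ_two] at h2
    exact h2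
  -- Induction on iterates bounds V by the loop's expectation; conversely, induction on computation
  -- length, using only that V is a fixed point, bounds the expectation by V.
  · apply le_antisymm
    · rw [hVs]
      refine iSup_le fun n => ?_
      induction n generalizing ρ with
      | zero => exact (pairing_zero ρ).trans_le zero_le
      | succ n ih =>
        rw [hWs, hΦ _ hρ, hloop, (hg _).2 _ (hM1 hρ)]
        gcongr
        exact runSum_mono ih (hM1 hρ)
    · rw [runSum_eq_iSup]
      refine iSup_le fun n => ?_
      induction n generalizing ρ with
      | zero => exact zero_le
      | succ n ih =>
        rw [boundedSum, tsum_steps_loop (boundedSum (pairing B.1) n), ← hfix, hΦ _ hρ,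
          (hg _).2 _ (hM1 hρ)]
        refine add_le_add ?_ ?_
        · cases n <;> exact le_rfl
        · exact (boundedSum_seq_le _ _ n (some S, _)).trans (runSum_mono ih (hM1 hρ))

theorem exists_isDual (S : Prog ty) : ∀ B, ∃ W, IsDual S B W := by
  induction S with
  | skip =>
    exact fun B => ⟨B, .skip _, fun ρ _ => by
      rw [runSum_some, tsum_steps_skip (runSum _), runSum_none]⟩
  | reset q =>
    intro B
    obtain ⟨W, h1, h2⟩ := (isKraus_reset q).exists_dual_pred fun _ => B
    refine ⟨W, .reset q _ _ ?_, fun ρ hρ => ?_⟩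
    · simpa only [adj_varKetBra] using h1
    · rw [runSum_some, tsum_steps_reset (runSum _), runSum_none, pairing_resetState q hρ B.2.1,
        h2 ρ hρ.1]
  | unitary X U hU =>
    intro B
    obtain ⟨W, h1, h2⟩ := (isKraus_unitary hU).exists_dual_pred fun _ => B
    refine ⟨W, .unitary X U hU _ _ ?_, fun ρ hρ => ?_⟩
    · exact hasOpSum_unique h1 fun ψ => hasSum_unique _
    · rw [runSum_some, tsum_steps_unitary (runSum _), runSum_none, h2 ρ hρ.1]
      simp
  | seq S₁ S₂ ih₁ ih₂ =>
    intro B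
    obtain ⟨W₂, h₂, e₂⟩ := ih₂ B
    obtain ⟨W₁, h₁, e₁⟩ := ih₁ W₂
    refine ⟨W₁, .seq h₁ h₂, fun ρ hρ => ?_⟩
    rw [e₁ ρ hρ, runSum_congr e₂ (c := (some S₁, ρ)) hρ, ← runSum_seq]
    rfl
  | measure X ι M hM S ih =>
    intro B
    choose W hW using fun m => ih m B
    obtain ⟨V, h1, h2⟩ := hM.isKraus.exists_dual_pred W
    refine ⟨V, .measure X ι M hM S _ _ _ (fun m => (hW m).1) h1, fun ρ hρ => ?_⟩
    rw [runSum_some, tsum_steps_measure (runSum _), h2 ρ hρ.1]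
    exact tsum_congr fun m => (hW m).2 _ (hM.isKraus.posTraceClass hρ m)
  | loop X M hM S ih => exact exists_isDual_loop hM ih

/-! ### Pure states -/

/-- In any orthonormal basis the diagonal entries are ⟨φ, bᵢ⟩⟨bᵢ, φ⟩, summable by Parseval. -/
theorem isPartialDensity_proj {C : Type u} {φ : L2 C} (hφ : ‖φ‖ = 1) :
    IsPartialDensity (proj φ) where
  positive := proj_isPositive φ
  traceOp ι b := by
    have h := b.summable_inner_mul_inner φ φ
    refine h.congr fun i => ?_
    rw [proj_apply, inner_smul_right]
  trace_le := by
    rw [trace_re (posTraceClass_proj φ), pairing_one_proj,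
      ← ofReal_norm_sq, hφ]
    simp

/-- With σ = ⟦S⟧(ρ), tr(Qσ) - tr(σ) = -tr((I - Q)σ) = -tr(Wρ), so correctness reads tr(Pρ) ≤ tr((I -
W)ρ). Pure states suffice to conclude. -/
theorem ParCorrect.le {P Q W : QPred ty} {S : Prog ty} (h : ParCorrect P S Q)
    (hW : IsDual S Q.compl W) : P.1 ≤ W.compl.1 := by
  have key : ∀ φ : L2 (Config ty), ‖φ‖ = 1 →
      pairing P.1 (proj φ) ≤ pairing W.compl.1 (proj φ) := by
    intro φ hφ
    have hρ := posTraceClass_proj φ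
    obtain ⟨hσ, hd⟩ := denote_posTraceClass S hρ
    have h1 := h _ (isPartialDensity_proj hφ)
    rw [trace_mul_re P.2.1 hρ, trace_mul_re Q.2.1 hσ, trace_re hρ, trace_re hσ] at h1
    have ne : ∀ (R : QPred ty) {ρ}, PosTraceClass ρ → pairing R.1 ρ ≠ ⊤ := fun R ρ hρ =>
      ne_top_of_le_ne_top hρ.2 (pairing_mono R.2.2 ρ)
    have split : ∀ (R : QPred ty) {ρ}, PosTraceClass ρ →
        (pairing 1 ρ).toReal = (pairing R.1 ρ).toReal + (pairing R.compl.1 ρ).toReal :=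
      fun R ρ hρ => by
        rw [← ENNReal.toReal_add (ne R hρ) (ne R.compl hρ), ← pairing_add R.2.1 R.compl.2.1]
        congr 2
        exact (add_sub_cancel _ _).symm
    have e : pairing W.1 (proj φ) = pairing Q.compl.1 (denote S (proj φ)) := by
      rw [hW.2 _ hρ, hd _ Q.compl.2.1]
    rw [← ENNReal.toReal_le_toReal (ne P hρ) (ne W.compl hρ)]
    have h2 := split Q hσ
    have h3 := split W hρ
    rw [e] at h3
    linarith
  refine le_of_quad_le P.2.1 W.compl.2.1 fun φ => ?_
  by_cases hφ : φ = 0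
  · simp [hφ, quad]
  have hn : ‖φ‖ ≠ 0 := norm_ne_zero_iff.2 hφ
  -- Only unit vectors were tested above; quadratic forms are homogeneous of degree two, and the
  -- positive factor ‖φ‖⁻² cancels.
  have h1 := key (((‖φ‖⁻¹ : ℝ) : ℂ) • φ) (by
    rw [norm_smul, Complex.norm_real, norm_inv, norm_norm, inv_mul_cancel₀ hn])
  rw [pairing_proj P.2.1, pairing_proj W.compl.2.1] at h1
  have h2 : ∀ A : GlobalOp ty, quad A (((‖φ‖⁻¹ : ℝ) : ℂ) • φ) =
      ENNReal.ofReal (‖φ‖⁻¹ * ‖φ‖⁻¹) * quad A φ := fun A => by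
    rw [quad, map_smul, inner_smul_left, inner_smul_right, Complex.conj_ofReal, ← mul_assoc,
      ← Complex.ofReal_mul, Complex.re_ofReal_mul, ENNReal.ofReal_mul (by positivity)]
    rfl
  rw [h2, h2] at h1
  refine (ENNReal.mul_le_mul_iff_right ?_ ENNReal.ofReal_ne_top).1 h1
  rw [Ne, ENNReal.ofReal_eq_zero, not_le]
  positivity

end Completeness

end QuantumWhile

theorem mainTheorem1 {Var : Type*} [Countable Var] [Infinite Var] (ty : Var → QType)
    (S : Prog ty) (P Q : QPred ty) (h : ParCorrect P S Q) :
    Provable P S Q := by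
  obtain ⟨W, hW⟩ := exists_isDual S Q.compl
  have hp := hW.1
  rw [Q.compl_compl] at hp
  exact .order (h.le hW) hp le_rfl
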